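/- Let $k$ be a field of characteristic zero, $q\in k$ with $q\neq 0,\pm1$, $\omega=q-q^{-1}$, and let $\mathfrak z$ be a commutative $k$-algebra that is an integral domain. Let $n\ge 1$, $A_0,\dots,A_n\in\mathfrak z$ and $p(u)=-u^{n+1}+A_0u^n+A_1u^{n-1}+\dots+A_n$, with $p(0)=A_n\neq 0$. Let $\mathcal H_p$ be the $\mathfrak z$-algebra with generators $R,K$ and relations $R^2=\omega R+1$, $RKRK=KRKR$, $p(K)=0$. Put $\mathfrak z(x)=\mathfrak z\otimes_k k(x)$, $\mathcal H_p(x)=\mathcal H_p\otimes_k k(x)$, $\mathcal H_p(x,y)=\mathcal H_p\otimes_k k(x,y)$ and $R(x)=R-x^{-1}R^{-1}$. A solution is an element $K(x)\in\mathcal H_p(x)$, polynomial in $K$ with coefficients in $\mathfrak z(x)$, such that in $\mathcal H_p(x,y)$ $$R(\tfrac xy)K(x)R(xy)K(y)=K(y)R(xy)K(x)R(\tfrac xy).$$ It is trivial if it lies in $\mathfrak z(x)$. Put $\tilde K=K^n-A_0K^{n-1}-\dots-A_{n-1}$, so that $K\tilde K=A_n$, and $\tilde K=A_nK^{-1}$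 if $K$ is invertible. A solution is small if $n>1$ and the coefficient of $K^{n-1}$ in its expansion over $1,K,\dots,K^{n-1},\tilde K$ is zero. Then: 1. Every non-trivial small solution has the form $a_+K+a_0+b\tilde K$ with $a_+,a_0,b\in\mathfrak z(x)$; in particular, if $K$ is invertible, it has the form $a_+K+a_0+a_-K^{-1}$ with $a_\pm,a_0\in\mathfrak z(x)$. 2. A non-trivial small solution can exist only for $n=3$. 3. Let $n=3$ and suppose that $-A_3$ has a square root $s=\sqrt{-A_3}$ in $\mathfrak z$. Then $$K_s(x)=x\,s\,K+\frac{A_0s+A_2x}{x-x^{-1}}+\tilde K$$ is a non-trivial small solution, where $\tilde K=A_3K^{-1}$ if $K$ is invertible. Every non-trivial small solution is equal to $f\,K_s(x)$ or to $f\,K_{-s}(x)$ for some $f\in\mathfrak z(x)$; that is, it is unique up to a factor from $\mathfrak z(x)$ and the choice of the square root of $-A_3$. -/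

import Mathlib

open scoped TensorProduct Polynomial

/-- The two generators of the (affine, cyclotomic) Hecke algebra of rank one. -/
inductive HeckeGen : Type
  | R : HeckeGen
  | K : HeckeGen

noncomputable section

namespace Baxter

/-- The defining relations, in the free algebra `𝔷⟨R, K⟩`, of the cyclotomic Hecke algebra:
the Hecke condition with `ω = q - q⁻¹`, the reflection equation, and `p(K) = 0`. -/
inductive Rel {k 𝔷 : Type*} [Field k] [CommRing 𝔷] [Algebra k 𝔷] (q : k) (p : 𝔷[X]) :
    FreeAlgebra 𝔷 HeckeGen → FreeAlgebra 𝔷 HeckeGen → Prop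
  | hecke : Rel q p (FreeAlgebra.ι 𝔷 HeckeGen.R ^ 2)
      (algebraMap k (FreeAlgebra 𝔷 HeckeGen) (q - q⁻¹) * FreeAlgebra.ι 𝔷 HeckeGen.R + 1)
  | reflection : Rel q p
      (FreeAlgebra.ι 𝔷 HeckeGen.R * FreeAlgebra.ι 𝔷 HeckeGen.K *
        FreeAlgebra.ι 𝔷 HeckeGen.R * FreeAlgebra.ι 𝔷 HeckeGen.K)
      (FreeAlgebra.ι 𝔷 HeckeGen.K * FreeAlgebra.ι 𝔷 HeckeGen.R *
        FreeAlgebra.ι 𝔷 HeckeGen.K * FreeAlgebra.ι 𝔷 HeckeGen.R)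
  | cyclotomic : Rel q p (Polynomial.aeval (FreeAlgebra.ι 𝔷 HeckeGen.K) p) 0

/-- The algebra `𝓗_p`: the quotient of `𝔷⟨R, K⟩` by the ideal of the relations above. -/
abbrev Hp {k 𝔷 : Type*} [Field k] [CommRing 𝔷] [Algebra k 𝔷] (q : k) (p : 𝔷[X]) : Type _ :=
  RingQuot (Rel q p)

/-- The generator `K` of `𝓗_p`. -/
def genK {k 𝔷 : Type*} [Field k] [CommRing 𝔷] [Algebra k 𝔷] (q : k) (p : 𝔷[X]) : Hp q p :=
  RingQuot.mkAlgHom 𝔷 (Rel q p) (FreeAlgebra.ι 𝔷 HeckeGen.K)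

/-- The image in `𝓗_p` of the generator `R`. -/
def genR' {k 𝔷 : Type*} [Field k] [CommRing 𝔷] [Algebra k 𝔷] (q : k) (p : 𝔷[X]) : Hp q p :=
  RingQuot.mkAlgHom 𝔷 (Rel q p) (FreeAlgebra.ι 𝔷 HeckeGen.R)

theorem genR'_sq {k 𝔷 : Type*} [Field k] [CommRing 𝔷] [Algebra k 𝔷] (q : k) (p : 𝔷[X]) :
    genR' q p ^ 2 = algebraMap k (Hp q p) (q - q⁻¹) * genR' q p + 1 := by
  have h := RingQuot.mkAlgHom_rel 𝔷 (Rel.hecke (q := q) (p := p))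
  rw [map_pow, map_add, map_mul, map_one] at h
  have e : RingQuot.mkAlgHom 𝔷 (Rel q p) (algebraMap k (FreeAlgebra 𝔷 HeckeGen) (q - q⁻¹)) =
      algebraMap k (Hp q p) (q - q⁻¹) := by
    rw [IsScalarTower.algebraMap_apply k 𝔷 (FreeAlgebra 𝔷 HeckeGen), AlgHom.commutes,
      ← IsScalarTower.algebraMap_apply k 𝔷]
  rw [e] at h
  exact h

/-- The generator `R` of `𝓗_p` as an invertible element; by the Hecke condition its inverse
is `R - ω`. -/
def genR {k 𝔷 : Type*} [Field k] [CommRing 𝔷] [Algebra k 𝔷] (q : k) (p : 𝔷[X]) : (Hp q p)ˣ where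
  val := genR' q p
  inv := genR' q p - algebraMap k (Hp q p) (q - q⁻¹)
  val_inv := by
    rw [mul_sub, ← sq, genR'_sq, ← Algebra.commutes]
    abel
  inv_val := by
    rw [sub_mul, ← sq, genR'_sq]
    abel

/-- `𝔷(x) = 𝔷 ⊗ k(x)`. -/
abbrev Zx (k 𝔷 : Type*) [Field k] [CommRing 𝔷] [Algebra k 𝔷] : Type _ := 𝔷 ⊗[k] RatFunc k

/-- `k(x, y)`; the variables `x`, `y` are the ones with index `0`, `1`. -/
abbrev Kxy (k : Type*) [Field k] : Type _ := FractionRing (MvPolynomial (Fin 2) k)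

/-- `𝓗_p(x) = 𝓗_p ⊗ k(x)`. -/
abbrev Hpx {k 𝔷 : Type*} [Field k] [CommRing 𝔷] [Algebra k 𝔷] (q : k) (p : 𝔷[X]) : Type _ :=
  Hp q p ⊗[k] RatFunc k

/-- `𝓗_p(x, y) = 𝓗_p ⊗ k(x, y)`. -/
abbrev Hpxy {k 𝔷 : Type*} [Field k] [CommRing 𝔷] [Algebra k 𝔷] (q : k) (p : 𝔷[X]) : Type _ :=
  Hp q p ⊗[k] Kxy k

/-- The variables `x` (index `0`) and `y` (index `1`) in `k(x, y)`. -/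
def var (k : Type*) [Field k] (i : Fin 2) : Kxy k :=
  algebraMap (MvPolynomial (Fin 2) k) (Kxy k) (MvPolynomial.X i)

theorem aeval_var_injective (k : Type*) [Field k] (i : Fin 2) :
    Function.Injective (Polynomial.aeval (R := k) (var k i)) := by
  have h : Function.Injective
      (Polynomial.aeval (R := k) (MvPolynomial.X i : MvPolynomial (Fin 2) k)) :=
    transcendental_iff_injective.1 (MvPolynomial.transcendental_X k i)
  have e : ⇑(Polynomial.aeval (R := k) (var k i)) =
      algebraMap (MvPolynomial (Fin 2) k) (Kxy k) ∘
        Polynomial.aeval (MvPolynomial.X i : MvPolynomial (Fin 2) k) := by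
    funext f
    exact Polynomial.aeval_algebraMap_apply (Kxy k) _ f
  rw [e]
  exact (IsFractionRing.injective (MvPolynomial (Fin 2) k) (Kxy k)).comp h

/-- The inclusion `k(x) → k(x, y)` that sends the variable of `k(x)` to `x` (for `i = 0`) or
to `y` (for `i = 1`). -/
def subst (k : Type*) [Field k] (i : Fin 2) : RatFunc k →ₐ[k] Kxy k :=
  RatFunc.liftAlgHom (Polynomial.aeval (var k i))
    (nonZeroDivisors_le_comap_nonZeroDivisors_of_injective _ (aeval_var_injective k i))

/-- For `K(x) ∈ 𝓗_p(x)` the elements `K(x)` (for `i = 0`) and `K(y)` (for `i = 1`)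
of `𝓗_p(x, y)`. -/
def evalAt {k 𝔷 : Type*} [Field k] [CommRing 𝔷] [Algebra k 𝔷] (q : k) (p : 𝔷[X]) (i : Fin 2) :
    Hpx q p →ₐ[k] Hpxy q p :=
  Algebra.TensorProduct.map (AlgHom.id k (Hp q p)) (subst k i)

/-- `R(t) = R - t⁻¹ R⁻¹ ∈ 𝓗_p(x, y)` for `t ∈ k(x, y)`. -/
def Rspec {k 𝔷 : Type*} [Field k] [CommRing 𝔷] [Algebra k 𝔷] (q : k) (p : 𝔷[X]) (t : Kxy k) :
    Hpxy q p :=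
  (genR q p : Hp q p) ⊗ₜ[k] (1 : Kxy k) - ((genR q p)⁻¹ : (Hp q p)ˣ).val ⊗ₜ[k] t⁻¹

/-- The reflection equation with spectral parameter in `𝓗_p(x, y)`:
`R(x/y) K(x) R(xy) K(y) = K(y) R(xy) K(x) R(x/y)`. -/
def IsSolution {k 𝔷 : Type*} [Field k] [CommRing 𝔷] [Algebra k 𝔷] (q : k) (p : 𝔷[X])
    (F : Hpx q p) : Prop :=
  Rspec q p (var k 0 / var k 1) * evalAt q p 0 F * Rspec q p (var k 0 * var k 1) * evalAt q p 1 F =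
  evalAt q p 1 F * Rspec q p (var k 0 * var k 1) * evalAt q p 0 F * Rspec q p (var k 0 / var k 1)

/-- The structure map `𝔷(x) → 𝓗_p(x)`. -/
def scal {k 𝔷 : Type*} [Field k] [CommRing 𝔷] [Algebra k 𝔷] (q : k) (p : 𝔷[X]) :
    Zx k 𝔷 →ₐ[k] Hpx q p :=
  Algebra.TensorProduct.map (IsScalarTower.toAlgHom k 𝔷 (Hp q p)) (AlgHom.id k (RatFunc k))

/-- The inclusion `𝓗_p → 𝓗_p(x)` as constant functions. -/
def const {k 𝔷 : Type*} [Field k] [CommRing 𝔷] [Algebra k 𝔷] (q : k) (p : 𝔷[X]) :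
    Hp q p →ₐ[k] Hpx q p :=
  Algebra.TensorProduct.includeLeft

/-- The solutions from `𝔷(x)` are called trivial. -/
def IsTrivial {k 𝔷 : Type*} [Field k] [CommRing 𝔷] [Algebra k 𝔷] (q : k) (p : 𝔷[X])
    (F : Hpx q p) : Prop :=
  ∃ f : Zx k 𝔷, F = scal q p f

/-- `p(u) = -u^(n+1) + A_0 u^n + A_1 u^(n-1) + ... + A_n`. Only `A 0, ..., A n` enter. -/
def poly {𝔷 : Type*} [CommRing 𝔷] (n : ℕ) (A : ℕ → 𝔷) : 𝔷[X] :=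
  -Polynomial.X ^ (n + 1) +
    ∑ i ∈ Finset.range (n + 1), Polynomial.C (A i) * Polynomial.X ^ (n - i)

/-- `K̃ = K^n - A_0 K^(n-1) - ... - A_(n-1)`, which satisfies `K K̃ = A_n`; so `K̃ = A_n K⁻¹`
whenever `K` is invertible. -/
def Ktilde {k 𝔷 : Type*} [Field k] [CommRing 𝔷] [Algebra k 𝔷] (q : k) (n : ℕ) (A : ℕ → 𝔷) :
    Hp q (poly n A) :=
  genK q (poly n A) ^ n -
    ∑ i ∈ Finset.range n, algebraMap 𝔷 (Hp q (poly n A)) (A i) * genK q (poly n A) ^ (n - 1 - i)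

/-- A solution `F`, polynomial in `K` with coefficients in `𝔷(x)`, is small if `n > 1` and the
coefficient of `K^(n-1)` vanishes in the expansion of `F` over `1, K, ..., K^(n-1), K̃`.
(These elements form a basis, so the expansion is unique.) -/
def IsSmallSolution {k 𝔷 : Type*} [Field k] [CommRing 𝔷] [Algebra k 𝔷] (q : k) (n : ℕ)
    (A : ℕ → 𝔷) (F : Hpx q (poly n A)) : Prop :=
  IsSolution q (poly n A) F ∧ 1 < n ∧
    ∃ (c : ℕ → Zx k 𝔷) (d : Zx k 𝔷),
      F = (∑ i ∈ Finset.range n,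
            scal q (poly n A) (c i) * const q (poly n A) (genK q (poly n A) ^ i)) +
          scal q (poly n A) d * const q (poly n A) (Ktilde q n A) ∧
      c (n - 1) = 0

/-- Non-trivial small solutions. -/
def IsNontrivialSmall {k 𝔷 : Type*} [Field k] [CommRing 𝔷] [Algebra k 𝔷] (q : k) (n : ℕ)
    (A : ℕ → 𝔷) (F : Hpx q (poly n A)) : Prop :=
  IsSmallSolution q n A F ∧ ¬ IsTrivial q (poly n A) F

/-- `x s K + (A_0 s + A_2 x) / (x - x⁻¹) + L`, an element of `𝓗_p(x)`, for `s ∈ 𝔷` and a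
constant `L ∈ 𝓗_p`. -/
def smallFormula {k 𝔷 : Type*} [Field k] [CommRing 𝔷] [Algebra k 𝔷] (q : k) (n : ℕ)
    (A : ℕ → 𝔷) (s : 𝔷) (L : Hp q (poly n A)) : Hpx q (poly n A) :=
  scal q (poly n A) (s ⊗ₜ[k] RatFunc.X) * const q (poly n A) (genK q (poly n A)) +
    scal q (poly n A)
      ((A 0 * s) ⊗ₜ[k] (1 / (RatFunc.X - RatFunc.X⁻¹)) +
        A 2 ⊗ₜ[k] (RatFunc.X / (RatFunc.X - RatFunc.X⁻¹))) +
    const q (poly n A) L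

end Baxter

end

/-! Write a small solution as a polynomial `F` in `K`, and let `F` and `G` be its values at `x` and
at `y`. Both live over the field `L = Frac 𝔷[x, y]`, into which `𝔷(x)` embeds by sending its
variable to either coordinate.

Necessity. No basis of `𝓗_p` is needed. The equation is tested on a principal series in which `R` is
`!![0, 1; 1, ω]` and `K` is upper triangular with eigenvalues `v` and `u`. Such a representation
exists when `p(u) = p(v) = 0` and `D = (p(u) - p(v)) / (u - v)` vanishes. The lower left entry of
the reflection equation, divided by `ω`, is a relation between `F(u)`, `F(v)`, `G(u)`, `G(v)` and
the symmetric element `H = (F(u) v - u F(v)) / (u - v)`. A priori it holds in `L[u, v] / (p(u),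
p(v))` only modulo `D`. But its left side is antisymmetric in `u`, `v`, while multiples of `D` are
symmetric because `D u = D v`. In characteristic zero it therefore holds without reduction
(`reflection_identity`).

What remains is comparison of coefficients. If `K^r` with `2 ≤ r < n - 1` is the top power besides
`K̃`, the monomial `u^(r+1) v^(r-1)` occurs only with coefficient proportional to `c_r(x) c_r(y)`,
so `c_r = 0` (`top_coeff_mul_eq_zero`). Hence `F = a K + b + d K̃`, and four families of
coefficients are left (`coeff_equations`). For `n ≠ 3` the products `d(x) d(y)` and `a(x) a(y)`
stand alone and vanish. For `n = 3` the relation `K³ = K̃ + A₀ K² + A₁ K + A₂` mixes them into `xy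
A₃ d(x) d(y) + a(x) a(y) = 0`. Together with the proportionality of `a` to `x d` this gives `a = ±s
x d`, and two linear equations then determine `b` (`coeff_equations_three`).

Existence. `R K R` commutes with `K`, hence with `K̃`. This yields exchange relations of `R K̃ R`
with `K` and with `K̃` (`conj_mul_K`, `conj_mul_tilde`). They reduce the difference of the two sides
of the equation to four commutator-like elements whose scalar coefficients all vanish
(`reflection_of_coeffs`). Non-triviality is seen in the commutative quotient where `R` becomes the
scalar `q`. -/

noncomputable section

namespace Baxter

/-! ### Embedding `𝔷(x)` and `k(x, y)` into one field -/

section FunctionField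

variable (k 𝔷 : Type*) [Field k] [CommRing 𝔷] [IsDomain 𝔷] [Algebra k 𝔷]

/-- The field of fractions of `𝔷[x, y]`. -/
abbrev FieldXY (𝔷 : Type*) [CommRing 𝔷] : Type _ := FractionRing (MvPolynomial (Fin 2) 𝔷)

/-- The variables of `FieldXY 𝔷`. -/
def coord (𝔷 : Type*) [CommRing 𝔷] (i : Fin 2) : FieldXY 𝔷 :=
  algebraMap (MvPolynomial (Fin 2) 𝔷) (FieldXY 𝔷) (MvPolynomial.X i)

theorem aeval_coord_injective :
    Function.Injective (MvPolynomial.aeval (R := k) (coord 𝔷)) := by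
  have e : ⇑(MvPolynomial.aeval (R := k) (coord 𝔷)) =
      algebraMap (MvPolynomial (Fin 2) 𝔷) (FieldXY 𝔷) ∘
        MvPolynomial.map (algebraMap k 𝔷) := by
    funext f
    induction f using MvPolynomial.induction_on with
    | C a =>
      simp only [MvPolynomial.algHom_C, Function.comp_apply, MvPolynomial.map_C]
      rw [IsScalarTower.algebraMap_apply k (MvPolynomial (Fin 2) 𝔷) (FieldXY 𝔷)]
      rfl
    | add f g hf hg => simp_all
    | mul_X f i hf => simp_all [coord]
  rw [e]
  exact (IsFractionRing.injective _ _).comp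
    (MvPolynomial.map_injective _ (algebraMap k 𝔷).injective)

/-- The inclusion of `k(x, y)` into the field of fractions of `𝔷[x, y]`. -/
def inclKxy : Kxy k →ₐ[k] FieldXY 𝔷 :=
  IsFractionRing.liftAlgHom (aeval_coord_injective k 𝔷)

theorem inclKxy_var (i : Fin 2) : inclKxy k 𝔷 (var k i) = coord 𝔷 i := by
  simp [inclKxy, var]

theorem subst_algebraMap (i : Fin 2) (f : k[X]) :
    subst k i (algebraMap k[X] (RatFunc k) f) = Polynomial.aeval (var k i) f := by
  have := RatFunc.liftAlgHom_apply_div (Polynomial.aeval (R := k) (var k i))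
    (nonZeroDivisors_le_comap_nonZeroDivisors_of_injective _ (aeval_var_injective k i)) f 1
  simpa [subst] using this

theorem subst_X (i : Fin 2) : subst k i RatFunc.X = var k i := by
  rw [← RatFunc.algebraMap_X, subst_algebraMap, Polynomial.aeval_X]

/-- The map `𝔷(x) → Frac 𝔷[x, y]` that sends the variable to the one with index `i`. -/
def evalZx (i : Fin 2) : Zx k 𝔷 →ₐ[𝔷] FieldXY 𝔷 :=
  Algebra.TensorProduct.lift (Algebra.ofId 𝔷 (FieldXY 𝔷)) ((inclKxy k 𝔷).comp (subst k i))
    fun _ _ => Commute.all _ _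

theorem evalZx_tmul (i : Fin 2) (a : 𝔷) (f : RatFunc k) :
    evalZx k 𝔷 i (a ⊗ₜ f) = algebraMap 𝔷 (FieldXY 𝔷) a * inclKxy k 𝔷 (subst k i f) := by
  simp [evalZx, Algebra.ofId_apply]

/-- Every element of `𝔷(x)` has a polynomial denominator from `k[x]`. -/
theorem exists_denominator (e : Zx k 𝔷) : ∃ g : k[X], g ≠ 0 ∧ ∃ P : 𝔷[X],
    e * (1 ⊗ₜ algebraMap k[X] (RatFunc k) g) =
      Polynomial.aeval (R := 𝔷) ((1 : 𝔷) ⊗ₜ[k] (RatFunc.X : RatFunc k)) P := by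
  have key : ∀ f : k[X], (1 : 𝔷) ⊗ₜ[k] algebraMap k[X] (RatFunc k) f =
      Polynomial.aeval (R := 𝔷) ((1 : 𝔷) ⊗ₜ[k] (RatFunc.X : RatFunc k))
        (f.map (algebraMap k 𝔷)) := by
    intro f
    rw [Polynomial.aeval_map_algebraMap]
    induction f using Polynomial.induction_on' with
    | add f g hf hg => simp only [map_add, TensorProduct.tmul_add, hf, hg]
    | monomial n a =>
      rw [← Polynomial.C_mul_X_pow_eq_monomial]
      simp only [map_mul, map_pow, RatFunc.algebraMap_X, RatFunc.algebraMap_C,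
        Polynomial.aeval_C, Polynomial.aeval_X, Algebra.TensorProduct.tmul_pow, one_pow]
      rw [← Algebra.smul_def, ← TensorProduct.tmul_smul, Algebra.smul_def]
      rfl
  induction e using TensorProduct.induction_on with
  | zero => exact ⟨1, one_ne_zero, 0, by simp⟩
  | tmul a f =>
    induction f using RatFunc.induction_on with
    | f p r hr =>
      refine ⟨r, hr, Polynomial.C a * p.map (algebraMap k 𝔷), ?_⟩
      have hr' : algebraMap k[X] (RatFunc k) r ≠ 0 := RatFunc.algebraMap_ne_zero hr
      rw [map_mul, ← key, Polynomial.aeval_C, Algebra.TensorProduct.tmul_mul_tmul,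
        div_mul_cancel₀ _ hr', Algebra.TensorProduct.algebraMap_apply,
        Algebra.TensorProduct.tmul_mul_tmul]
      simp
  | add e f he hf =>
    obtain ⟨g, hg, P, hP⟩ := he
    obtain ⟨h, hh, Q, hQ⟩ := hf
    refine ⟨g * h, mul_ne_zero hg hh,
      P * h.map (algebraMap k 𝔷) + Q * g.map (algebraMap k 𝔷), ?_⟩
    have hm : (1 : 𝔷) ⊗ₜ[k] algebraMap k[X] (RatFunc k) (g * h) =
        ((1 : 𝔷) ⊗ₜ[k] algebraMap k[X] (RatFunc k) g) *
          ((1 : 𝔷) ⊗ₜ[k] algebraMap k[X] (RatFunc k) h) := by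
      rw [Algebra.TensorProduct.tmul_mul_tmul, map_mul, one_mul]
    rw [hm, map_add, map_mul (Polynomial.aeval _), map_mul (Polynomial.aeval _), ← hP, ← hQ,
      ← key, ← key]
    ring

/-- A denominator from `k[x]` is a unit of `𝔷(x)`, so injectivity only has to be checked on
polynomials over `𝔷`, where it is the transcendence of a coordinate. -/
theorem evalZx_injective (i : Fin 2) : Function.Injective (evalZx k 𝔷 i) := by
  rw [injective_iff_map_eq_zero]
  intro e he
  obtain ⟨g, hg, P, hP⟩ := exists_denominator k 𝔷 e
  have h := congrArg (evalZx k 𝔷 i) hP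
  rw [map_mul, he, zero_mul, ← Polynomial.aeval_algHom_apply, evalZx_tmul, subst_X,
    inclKxy_var, map_one, one_mul, coord, Polynomial.aeval_algebraMap_apply] at h
  have hP0 : P = 0 := by
    have h1 := (map_eq_zero_iff _ (IsFractionRing.injective (MvPolynomial (Fin 2) 𝔷)
      (FieldXY 𝔷))).1 h.symm
    exact (map_eq_zero_iff _
      (transcendental_iff_injective.1 (MvPolynomial.transcendental_X 𝔷 i))).1 h1
  rw [hP0, map_zero] at hP
  have hu : ((1 : 𝔷) ⊗ₜ[k] algebraMap k[X] (RatFunc k) g) *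
      ((1 : 𝔷) ⊗ₜ[k] (algebraMap k[X] (RatFunc k) g)⁻¹) = 1 := by
    rw [Algebra.TensorProduct.tmul_mul_tmul, mul_inv_cancel₀ (RatFunc.algebraMap_ne_zero hg),
      one_mul, Algebra.TensorProduct.one_def]
  calc e = e * (1 ⊗ₜ algebraMap k[X] (RatFunc k) g) *
        ((1 : 𝔷) ⊗ₜ[k] (algebraMap k[X] (RatFunc k) g)⁻¹) := by rw [mul_assoc, hu, mul_one]
    _ = 0 := by rw [hP, zero_mul]

theorem coord_ne_zero (i : Fin 2) : coord 𝔷 i ≠ 0 := fun h => MvPolynomial.X_ne_zero i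
  ((map_eq_zero_iff _ (IsFractionRing.injective (MvPolynomial (Fin 2) 𝔷) (FieldXY 𝔷))).1 h)

theorem coord_zero_ne_coord_one : coord 𝔷 0 ≠ coord 𝔷 1 := fun h => by
  have := (IsFractionRing.injective (MvPolynomial (Fin 2) 𝔷) (FieldXY 𝔷)) h
  exact absurd (MvPolynomial.X_injective this) (by decide)

theorem coord_mul_coord_ne_one : coord 𝔷 0 * coord 𝔷 1 ≠ 1 := fun h => by
  rw [coord, coord, ← map_mul, ← map_one (algebraMap (MvPolynomial (Fin 2) 𝔷) (FieldXY 𝔷))] at h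
  have h1 := (IsFractionRing.injective (MvPolynomial (Fin 2) 𝔷) (FieldXY 𝔷)) h
  have h2 := congrArg (MvPolynomial.eval (0 : Fin 2 → 𝔷)) h1
  simp at h2

theorem coord_sq_ne_one (i : Fin 2) : coord 𝔷 i ^ 2 ≠ 1 := fun h => by
  rw [coord, ← map_pow, ← map_one (algebraMap (MvPolynomial (Fin 2) 𝔷) (FieldXY 𝔷))] at h
  have h1 := (IsFractionRing.injective (MvPolynomial (Fin 2) 𝔷) (FieldXY 𝔷)) h
  have h2 := congrArg (MvPolynomial.eval (0 : Fin 2 → 𝔷)) h1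
  simp at h2

end FunctionField

/-! ### Polynomials in triangular matrices and divided differences -/

section Triangular

variable {B T : Type*} [CommRing B] [CommRing T] [Algebra B T]

/-- The divided difference `(f(a) - f(c)) / (a - c)`. -/
def dividedDiff (f : B[X]) (a c : T) : T :=
  ∑ i ∈ Finset.range (f.natDegree + 1),
    f.coeff i • ∑ j ∈ Finset.range i, a ^ j * c ^ (i - 1 - j)

theorem dividedDiff_comm (f : B[X]) (a c : T) : dividedDiff f a c = dividedDiff f c a := by
  simp only [dividedDiff, geom_sum₂_comm a c]

theorem dividedDiff_mul_sub (f : B[X]) (a c : T) :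
    dividedDiff f a c * (a - c) = Polynomial.aeval a f - Polynomial.aeval c f := by
  simp only [dividedDiff, Finset.sum_mul, smul_mul_assoc, (Commute.all a c).geom_sum₂_mul,
    Polynomial.aeval_eq_sum_range, smul_sub, Finset.sum_sub_distrib]

theorem map_dividedDiff {T' : Type*} [CommRing T'] [Algebra B T'] (g : T →ₐ[B] T') (f : B[X])
    (a c : T) : g (dividedDiff f a c) = dividedDiff f (g a) (g c) := by
  simp [dividedDiff, map_sum, map_smul]

theorem triangular_pow (a b c : T) (i : ℕ) :
    !![a, b; 0, c] ^ i =
      !![a ^ i, b * ∑ j ∈ Finset.range i, a ^ j * c ^ (i - 1 - j); 0, c ^ i] := by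
  induction i with
  | zero => simp [Matrix.one_fin_two]
  | succ i ih =>
    have h : ∑ j ∈ Finset.range (i + 1), a ^ j * c ^ (i + 1 - 1 - j) =
        (∑ j ∈ Finset.range i, a ^ j * c ^ (i - 1 - j)) * c + a ^ i := by
      rw [Finset.sum_range_succ, Finset.sum_mul]
      congr 1
      · refine Finset.sum_congr rfl fun j hj => ?_
        rw [Finset.mem_range] at hj
        rw [mul_assoc, ← pow_succ]
        congr 2
        omega
      · simp
    rw [pow_succ, ih, Matrix.mul_fin_two, h]
    congr 1
    ext i j
    fin_cases i <;> fin_cases j <;> simp <;> ring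

theorem aeval_triangular (f : B[X]) (a b c : T) :
    Polynomial.aeval !![a, b; 0, c] f =
      !![Polynomial.aeval a f, b * dividedDiff f a c; 0, Polynomial.aeval c f] := by
  simp only [Polynomial.aeval_eq_sum_range, triangular_pow, dividedDiff]
  ext i j
  fin_cases i <;> fin_cases j <;> simp [Matrix.sum_apply, Finset.mul_sum]

end Triangular

/-! ### The principal series -/

section Representation

variable {k 𝔷 T : Type*} [Field k] [CommRing 𝔷] [Algebra k 𝔷] [CommRing T] [Algebra k T]
  [Algebra 𝔷 T] [IsScalarTower k 𝔷 T] (q : k) (p : 𝔷[X])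

/-- The image of `q - q⁻¹` in a `k`-algebra. -/
abbrev omega (T : Type*) [CommRing T] [Algebra k T] (q : k) : T := algebraMap k T (q - q⁻¹)

/-- An algebra homomorphism out of `𝓗_p` from images of `R` and `K` that satisfy the relations. -/
def liftHp {M : Type*} [Ring M] [Algebra 𝔷 M] [Algebra k M] [IsScalarTower k 𝔷 M] (r κ : M)
    (h₁ : r ^ 2 = algebraMap k M (q - q⁻¹) * r + 1) (h₂ : r * κ * r * κ = κ * r * κ * r)
    (h₃ : Polynomial.aeval κ p = 0) : Hp q p →ₐ[𝔷] M :=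
  RingQuot.liftAlgHom 𝔷 ⟨FreeAlgebra.lift 𝔷 (fun g => HeckeGen.casesOn g r κ), by
    intro a b h
    cases h with
    | hecke =>
      rw [IsScalarTower.algebraMap_apply k 𝔷 (FreeAlgebra 𝔷 HeckeGen)]
      simp only [map_pow, map_add, map_mul, map_one, AlgHom.commutes, FreeAlgebra.lift_ι_apply]
      rw [h₁, IsScalarTower.algebraMap_apply k 𝔷 M]
    | reflection => simpa only [map_mul, FreeAlgebra.lift_ι_apply] using h₂
    | cyclotomic =>
      rw [← Polynomial.aeval_algHom_apply, FreeAlgebra.lift_ι_apply, map_zero]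
      exact h₃⟩

section
variable {M : Type*} [Ring M] [Algebra 𝔷 M] [Algebra k M] [IsScalarTower k 𝔷 M] (r κ : M)
    (h₁ : r ^ 2 = algebraMap k M (q - q⁻¹) * r + 1) (h₂ : r * κ * r * κ = κ * r * κ * r)
    (h₃ : Polynomial.aeval κ p = 0)

theorem liftHp_genK : liftHp q p r κ h₁ h₂ h₃ (genK q p) = κ := by
  rw [liftHp, genK, RingQuot.liftAlgHom_mkAlgHom_apply, FreeAlgebra.lift_ι_apply]

theorem liftHp_genR' : liftHp q p r κ h₁ h₂ h₃ (genR' q p) = r := by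
  rw [liftHp, genR', RingQuot.liftAlgHom_mkAlgHom_apply, FreeAlgebra.lift_ι_apply]

end

/-- The two-dimensional principal series representation of `𝓗_p` with parameters `u`, `v`. -/
def principalSeries (u v : T) (hu : Polynomial.aeval u p = 0) (hv : Polynomial.aeval v p = 0)
    (hd : dividedDiff p v u = 0) : Hp q p →ₐ[𝔷] Matrix (Fin 2) (Fin 2) T :=
  liftHp q p !![0, 1; 1, omega T q] !![v, -(omega T q * u); 0, u]
    (by
      rw [sq, Matrix.mul_fin_two, Matrix.algebraMap_eq_diagonal]
      ext i j
      fin_cases i <;> fin_cases j <;> simp [Matrix.mul_apply, Fin.sum_univ_two] <;> ring)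
    (by
      simp only [Matrix.mul_fin_two]
      ext i j
      fin_cases i <;> fin_cases j <;> simp <;> ring)
    (by
      -- The off-diagonal entry of `p(K)` is a multiple of the divided difference of `p`; the
      -- condition `hd` makes it vanish.
      rw [aeval_triangular, hu, hv, hd]
      ext i j
      fin_cases i <;> fin_cases j <;> simp)

variable (u v : T) (hu : Polynomial.aeval u p = 0) (hv : Polynomial.aeval v p = 0)
    (hd : dividedDiff p v u = 0)

theorem principalSeries_genK : principalSeries q p u v hu hv hd (genK q p) =
    !![v, -(omega T q * u); 0, u] := by
  rw [principalSeries, liftHp_genK]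

theorem principalSeries_genR' : principalSeries q p u v hu hv hd (genR' q p) =
    !![0, 1; 1, omega T q] := by
  rw [principalSeries, liftHp_genR']

end Representation

/-! ### The element `K̃` and the relation `K K̃ = A_n` -/

section Tilde

variable {𝔷 M : Type*} [CommRing 𝔷] [Ring M] [Algebra 𝔷 M] (n : ℕ) (A : ℕ → 𝔷)

/-- The polynomial `u^n - A_0 u^(n-1) - ... - A_(n-1)`. -/
def tildePoly : 𝔷[X] :=
  Polynomial.X ^ n - ∑ i ∈ Finset.range n, Polynomial.C (A i) * Polynomial.X ^ (n - 1 - i)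

theorem aeval_tildePoly (κ : M) : Polynomial.aeval κ (tildePoly n A) =
    κ ^ n - ∑ i ∈ Finset.range n, algebraMap 𝔷 M (A i) * κ ^ (n - 1 - i) := by
  simp [tildePoly, map_sum]

theorem X_mul_tildePoly :
    Polynomial.X * tildePoly n A = Polynomial.C (A n) - poly n A := by
  have h : ∑ i ∈ Finset.range n, Polynomial.C (A i) * Polynomial.X ^ (n - i) =
      Polynomial.X * ∑ i ∈ Finset.range n, Polynomial.C (A i) * Polynomial.X ^ (n - 1 - i) := by
    rw [Finset.mul_sum]
    refine Finset.sum_congr rfl fun i hi => ?_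
    rw [Finset.mem_range] at hi
    rw [show n - i = n - 1 - i + 1 by omega, pow_succ]
    ring
  rw [tildePoly, poly, Finset.sum_range_succ, h, Nat.sub_self]
  ring

theorem mul_aeval_tildePoly {κ : M} (hκ : Polynomial.aeval κ (poly n A) = 0) :
    κ * Polynomial.aeval κ (tildePoly n A) = algebraMap 𝔷 M (A n) := by
  have h := congrArg (Polynomial.aeval κ) (X_mul_tildePoly n A)
  simpa [hκ] using h

theorem poly_eval_zero : (poly n A).eval 0 = A n := by
  have h := congrArg (Polynomial.eval 0) (X_mul_tildePoly n A)
  simp only [Polynomial.eval_mul, Polynomial.eval_X, zero_mul, Polynomial.eval_sub,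
    Polynomial.eval_C] at h
  exact (sub_eq_zero.1 h.symm).symm

end Tilde

section Generators

variable {k 𝔷 : Type*} [Field k] [CommRing 𝔷] [Algebra k 𝔷] (q : k)

theorem aeval_genK (p : 𝔷[X]) : Polynomial.aeval (genK q p) p = 0 := by
  have h := RingQuot.mkAlgHom_rel 𝔷 (Rel.cyclotomic (q := q) (p := p))
  rwa [map_zero, ← Polynomial.aeval_algHom_apply] at h

theorem genR'_mul_genK (p : 𝔷[X]) : genR' q p * genK q p * genR' q p * genK q p =
    genK q p * genR' q p * genK q p * genR' q p := by
  have h := RingQuot.mkAlgHom_rel 𝔷 (Rel.reflection (q := q) (p := p))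
  simp only [map_mul] at h
  exact h

theorem Ktilde_eq_aeval (n : ℕ) (A : ℕ → 𝔷) :
    Ktilde q n A = Polynomial.aeval (genK q (poly n A)) (tildePoly n A) := by
  rw [aeval_tildePoly, Ktilde]

theorem genK_mul_Ktilde (n : ℕ) (A : ℕ → 𝔷) :
    genK q (poly n A) * Ktilde q n A = algebraMap 𝔷 _ (A n) := by
  rw [Ktilde_eq_aeval, mul_aeval_tildePoly _ _ (aeval_genK q _)]

end Generators

/-! ### Extending representations to spectral parameters -/

section ScalarExtension

variable {k 𝔷 T : Type*} [Field k] [CommRing 𝔷] [IsDomain 𝔷] [Algebra k 𝔷] [CommRing T]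
  [Algebra k T] [Algebra 𝔷 T] [IsScalarTower k 𝔷 T] [Algebra (FieldXY 𝔷) T]
  [IsScalarTower k (FieldXY 𝔷) T] [IsScalarTower 𝔷 (FieldXY 𝔷) T] {q : k} {p : 𝔷[X]}

/-- The extension of a matrix representation of `𝓗_p` to `𝓗_p(x, y)`. -/
def extendRep (ρ : Hp q p →ₐ[𝔷] Matrix (Fin 2) (Fin 2) T) :
    Hpxy q p →ₐ[k] Matrix (Fin 2) (Fin 2) T :=
  Algebra.TensorProduct.lift (ρ.restrictScalars k)
    (((IsScalarTower.toAlgHom k T (Matrix (Fin 2) (Fin 2) T)).comp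
      (IsScalarTower.toAlgHom k (FieldXY 𝔷) T)).comp (inclKxy k 𝔷))
    fun a f => Algebra.commute_algebraMap_right
      (algebraMap (FieldXY 𝔷) T (inclKxy k 𝔷 f)) (ρ a)

variable (ρ : Hp q p →ₐ[𝔷] Matrix (Fin 2) (Fin 2) T)

theorem extendRep_tmul (h : Hp q p) (f : Kxy k) : extendRep ρ (h ⊗ₜ f) =
    ρ h * algebraMap T _ (algebraMap (FieldXY 𝔷) T (inclKxy k 𝔷 f)) :=
  Algebra.TensorProduct.lift_tmul _ _ _ _ _

theorem extendRep_evalAt_scal (i : Fin 2) (e : Zx k 𝔷) :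
    extendRep ρ (evalAt q p i (scal q p e)) =
      algebraMap T _ (algebraMap (FieldXY 𝔷) T (evalZx k 𝔷 i e)) := by
  induction e using TensorProduct.induction_on with
  | zero => simp
  | tmul a f =>
    have : evalAt q p i (scal q p (a ⊗ₜ f)) = algebraMap 𝔷 (Hp q p) a ⊗ₜ subst k i f := by
      simp [evalAt, scal]
    rw [this, extendRep_tmul, AlgHom.commutes, evalZx_tmul, map_mul, map_mul,
      IsScalarTower.algebraMap_apply 𝔷 T (Matrix (Fin 2) (Fin 2) T),
      IsScalarTower.algebraMap_apply 𝔷 (FieldXY 𝔷) T]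
  | add e f he hf => simp only [map_add, he, hf]

theorem extendRep_evalAt_const (i : Fin 2) (h : Hp q p) :
    extendRep ρ (evalAt q p i (const q p h)) = ρ h := by
  have : evalAt q p i (const q p h) = h ⊗ₜ 1 := by
    simp [evalAt, const]
  rw [this, extendRep_tmul, map_one, map_one, map_one, mul_one]

theorem extendRep_Rspec (τ : Kxy k) : extendRep ρ (Rspec q p τ) = ρ (genR' q p) -
    algebraMap (FieldXY 𝔷) T (inclKxy k 𝔷 τ)⁻¹ •
      (ρ (genR' q p) - algebraMap k _ (q - q⁻¹)) := by
  have h : ρ (algebraMap k (Hp q p) (q - q⁻¹)) = algebraMap k _ (q - q⁻¹) := by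
    rw [IsScalarTower.algebraMap_apply k 𝔷 (Hp q p), AlgHom.commutes,
      ← IsScalarTower.algebraMap_apply k 𝔷]
  have h' : (((genR q p)⁻¹ : (Hp q p)ˣ) : Hp q p) =
      genR' q p - algebraMap k (Hp q p) (q - q⁻¹) := rfl
  rw [Rspec, map_sub, extendRep_tmul, extendRep_tmul, h', map_sub, h, map_inv₀, map_one, map_one,
    map_one, mul_one, ← Algebra.commutes, ← Algebra.smul_def]
  rfl

end ScalarExtension

/-! ### The scalar relation inside the reflection equation -/

section Entry

variable {T : Type*} [CommRing T]

/-- The lower left entry of the reflection equation for triangular matrices. -/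
theorem reflection_entry {w Fu Fv Gu Gv H H' r s : T} (hw : IsUnit w) {a c₁ c₂ c₃ : T}
    (h₁ : c₁ = a * ((1 - r) * (1 - s))) (h₂ : c₂ = a * (r * (1 - s)))
    (h₃ : c₃ = a * (s * (1 - r)))
    (h : (!![0, 1; 1, w] - r • (!![0, 1; 1, w] - w • 1)) * !![Fv, -(w * (H + Fu)); 0, Fu] *
        (!![0, 1; 1, w] - s • (!![0, 1; 1, w] - w • 1)) * !![Gv, -(w * (H' + Gu)); 0, Gu] =
      !![Gv, -(w * (H' + Gu)); 0, Gu] * (!![0, 1; 1, w] - s • (!![0, 1; 1, w] - w • 1)) *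
        !![Fv, -(w * (H + Fu)); 0, Fu] *
        (!![0, 1; 1, w] - r • (!![0, 1; 1, w] - w • (1 : Matrix (Fin 2) (Fin 2) T)))) :
    c₁ * ((Gu - Gv) * H) + c₂ * (Fu * Gv - Gu * Fv) + c₃ * (Fv * Gv - Fu * Gu) = 0 := by
  have hR (r : T) : !![0, 1; 1, w] - r • (!![0, 1; 1, w] - w • (1 : Matrix (Fin 2) (Fin 2) T)) =
      !![r * w, 1 - r; 1 - r, w] := by
    ext i j
    fin_cases i <;> fin_cases j <;> simp
  simp only [hR, Matrix.mul_fin_two] at h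
  have h10 := congrFun (congrFun h 1) 0
  simp only [Matrix.of_apply, Matrix.cons_val', Matrix.cons_val_zero, Matrix.cons_val_one,
    Matrix.cons_val_fin_one] at h10
  -- The lower left entry, scaled by `a`, is `w` times the wanted relation. The factor `a` is free,
  -- so that denominators in `r` and `s` can be cleared later.
  refine hw.mul_left_cancel ?_
  rw [h₁, h₂, h₃]
  linear_combination a * h10

end Entry

/-! ### `L[u] / p(u)` and its dual functionals -/

section RootAlgebra

variable {𝔷 : Type*} (L : Type*) [CommRing 𝔷] [Field L] [Algebra 𝔷 L] (n : ℕ) (A : ℕ → 𝔷)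

/-- The monic polynomial `-p` over `L`. -/
def monicPoly : L[X] := -(poly n A).map (algebraMap 𝔷 L)

/-- The commutative algebra `L[u] / p(u)`. -/
abbrev RootAlg : Type _ := AdjoinRoot (monicPoly L n A)

/-- The root of `p` in `L[u] / p(u)`. -/
abbrev rt : RootAlg L n A := AdjoinRoot.root (monicPoly L n A)

/-- The element `u^n - A_0 u^(n-1) - ... - A_(n-1)` of `L[u] / p(u)`. -/
def rtTilde : RootAlg L n A := Polynomial.aeval (rt L n A) (tildePoly n A)

theorem aeval_rt : Polynomial.aeval (rt L n A) (poly n A) = 0 := by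
  have h : Polynomial.aeval (rt L n A) (monicPoly L n A) = 0 := by
    rw [AdjoinRoot.aeval_eq, AdjoinRoot.mk_self]
  have e : Polynomial.aeval (rt L n A) (monicPoly L n A) =
      -Polynomial.aeval (rt L n A) (poly n A) := by
    rw [← Polynomial.aeval_map_algebraMap L (rt L n A) (poly n A), ← map_neg]
    rfl
  rwa [e, neg_eq_zero] at h

theorem rt_mul_rtTilde : rt L n A * rtTilde L n A = algebraMap 𝔷 _ (A n) :=
  mul_aeval_tildePoly n A (aeval_rt L n A)

theorem monicPoly_eq : monicPoly L n A = Polynomial.X ^ (n + 1) -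
    ∑ i ∈ Finset.range (n + 1), Polynomial.C (algebraMap 𝔷 L (A i)) * Polynomial.X ^ (n - i) := by
  simp [monicPoly, poly, Polynomial.map_sum, sub_eq_neg_add, add_comm]

theorem degree_lower_lt (c : ℕ → L) :
    (∑ i ∈ Finset.range (n + 1), Polynomial.C (c i) * Polynomial.X ^ (n - i)).degree <
      ((n + 1 : ℕ) : WithBot ℕ) := by
  refine (Polynomial.degree_sum_le _ _).trans_lt ?_
  rw [Finset.sup_lt_iff (WithBot.bot_lt_coe _)]
  intro i _
  refine (Polynomial.degree_C_mul_X_pow_le _ _).trans_lt ?_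
  exact_mod_cast (by omega : n - i < n + 1)

theorem monicPoly_monic : (monicPoly L n A).Monic := by
  rw [monicPoly_eq]
  exact Polynomial.monic_X_pow_sub (degree_lower_lt L n _)

theorem degree_monicPoly : (monicPoly L n A).degree = (n + 1 : ℕ) := by
  rw [monicPoly_eq, Polynomial.degree_sub_eq_left_of_degree_lt, Polynomial.degree_X_pow]
  rw [Polynomial.degree_X_pow]
  exact degree_lower_lt L n _

/-- The coordinates with respect to the powers of the root. -/
def coordFun (i : ℕ) : RootAlg L n A →ₗ[L] L :=
  Polynomial.lcoeff L i ∘ₗ AdjoinRoot.modByMonicHom (monicPoly_monic L n A)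

theorem coordFun_pow (i : ℕ) {j : ℕ} (hj : j ≤ n) :
    coordFun L n A i (rt L n A ^ j) = if j = i then 1 else 0 := by
  have h : rt L n A ^ j = AdjoinRoot.mk (monicPoly L n A) (Polynomial.X ^ j) := by
    rw [map_pow, AdjoinRoot.mk_X]
  rw [coordFun, LinearMap.comp_apply, h, AdjoinRoot.modByMonicHom_mk,
    (Polynomial.modByMonic_eq_self_iff (monicPoly_monic L n A)).2, Polynomial.lcoeff_apply,
    Polynomial.coeff_X_pow]
  · simp only [eq_comm]
  · rw [degree_monicPoly, Polynomial.degree_X_pow]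
    exact_mod_cast Nat.lt_succ_of_le hj

theorem rtTilde_eq : rtTilde L n A = rt L n A ^ n -
    ∑ i ∈ Finset.range n, algebraMap 𝔷 L (A i) • rt L n A ^ (n - 1 - i) := by
  rw [rtTilde, aeval_tildePoly]
  simp only [Algebra.smul_def, ← IsScalarTower.algebraMap_apply 𝔷 L]

/-- The functional dual to `K̃` in the basis `1, K, ..., K^(n-1), K̃`. -/
theorem exists_dual_tilde : ∃ φ : RootAlg L n A →ₗ[L] L, φ (rtTilde L n A) = 1 ∧
    ∀ j < n, φ (rt L n A ^ j) = 0 := by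
  refine ⟨coordFun L n A n, ?_, fun j hj => ?_⟩
  · rw [rtTilde_eq, map_sub, coordFun_pow L n A n le_rfl, if_pos rfl, map_sum,
      Finset.sum_eq_zero, sub_zero]
    intro i hi
    rw [Finset.mem_range] at hi
    rw [map_smul, coordFun_pow L n A n (by omega), if_neg (by omega), smul_zero]
  · rw [coordFun_pow L n A n hj.le, if_neg hj.ne]

/-- The functional dual to `K^i` in the basis `1, K, ..., K^(n-1), K̃`. -/
theorem exists_dual_pow (i : ℕ) : ∃ φ : RootAlg L n A →ₗ[L] L, φ (rtTilde L n A) = 0 ∧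
    ∀ j < n, φ (rt L n A ^ j) = if j = i then 1 else 0 := by
  obtain ⟨φ, h, h'⟩ := exists_dual_tilde L n A
  -- Since `φ` vanishes on the lower powers, this correction kills `K̃` without disturbing the
  -- values on `K^j`, `j < n`.
  refine ⟨coordFun L n A i - coordFun L n A i (rtTilde L n A) • φ, ?_, fun j hj => ?_⟩
  · simp [h]
  · simp [h' j hj, coordFun_pow L n A i hj.le]

end RootAlgebra

/-! ### Symmetry in `L[u, v] / (p(u), p(v))` -/

section TensorSquare

variable {𝔷 : Type*} (L : Type*) [CommRing 𝔷] [Field L] [Algebra 𝔷 L] (n : ℕ) (A : ℕ → 𝔷)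

/-- The algebra `L[u, v] / (p(u), p(v))`. -/
abbrev TensorSq : Type _ := RootAlg L n A ⊗[L] RootAlg L n A

/-- The exchange of the two factors of `L[u, v] / (p(u), p(v))`. -/
abbrev swapTS : TensorSq L n A ≃ₐ[L] TensorSq L n A :=
  Algebra.TensorProduct.comm L (RootAlg L n A) (RootAlg L n A)

/-- The divided difference `(p(u) - p(v)) / (u - v)`. -/
def discr : TensorSq L n A := dividedDiff (poly n A) (1 ⊗ₜ rt L n A) (rt L n A ⊗ₜ 1)

theorem swap_discr : swapTS L n A (discr L n A) = discr L n A := by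
  have h := map_dividedDiff ((swapTS L n A).toAlgHom.restrictScalars 𝔷) (poly n A)
    (1 ⊗ₜ rt L n A) (rt L n A ⊗ₜ 1)
  rw [discr]
  refine h.trans ?_
  rw [dividedDiff_comm]
  rfl

theorem aeval_rt_left : Polynomial.aeval (rt L n A ⊗ₜ[L] (1 : RootAlg L n A)) (poly n A) = 0 := by
  have h := Polynomial.aeval_algHom_apply ((Algebra.TensorProduct.includeLeft :
    RootAlg L n A →ₐ[L] TensorSq L n A).restrictScalars 𝔷) (rt L n A) (poly n A)
  rw [aeval_rt, map_zero] at h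
  exact h

theorem aeval_rt_right : Polynomial.aeval ((1 : RootAlg L n A) ⊗ₜ[L] rt L n A) (poly n A) = 0 := by
  have h := Polynomial.aeval_algHom_apply ((Algebra.TensorProduct.includeRight :
    RootAlg L n A →ₐ[L] TensorSq L n A).restrictScalars 𝔷) (rt L n A) (poly n A)
  rw [aeval_rt, map_zero] at h
  exact h

/-- The product of the divided difference with `v - u` is `p(v) - p(u) = 0`, so `u` and `v` act
identically on the ideal it generates. -/
theorem discr_mul_left (a : RootAlg L n A) :
    discr L n A * (a ⊗ₜ 1) = discr L n A * (1 ⊗ₜ a) := by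
  have h0 : discr L n A * (1 ⊗ₜ rt L n A - rt L n A ⊗ₜ 1) = 0 := by
    rw [discr, dividedDiff_mul_sub, aeval_rt_left, aeval_rt_right, sub_zero]
  have h1 : discr L n A * (rt L n A ⊗ₜ 1) = discr L n A * (1 ⊗ₜ rt L n A) := by
    rw [mul_sub] at h0
    exact (sub_eq_zero.1 h0).symm
  have h2 (j : ℕ) : discr L n A * ((rt L n A ^ j) ⊗ₜ 1) = discr L n A * (1 ⊗ₜ (rt L n A ^ j)) := by
    induction j with
    | zero => rfl
    | succ j ih =>
      have e1 : (rt L n A ^ (j + 1)) ⊗ₜ[L] (1 : RootAlg L n A) =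
          ((rt L n A ^ j) ⊗ₜ 1) * (rt L n A ⊗ₜ 1) := by simp [pow_succ]
      have e2 : (1 : RootAlg L n A) ⊗ₜ[L] (rt L n A ^ (j + 1)) =
          (1 ⊗ₜ (rt L n A ^ j)) * (1 ⊗ₜ rt L n A) := by simp [pow_succ]
      rw [e1, e2, ← mul_assoc, ih, mul_right_comm, h1]
      ring
  induction a using AdjoinRoot.induction_on with
  | ih f =>
    induction f using Polynomial.induction_on' with
    | add f g hf hg =>
      rw [map_add, TensorProduct.add_tmul, TensorProduct.tmul_add, mul_add, mul_add, hf, hg]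
    | monomial j c =>
      have : AdjoinRoot.mk (monicPoly L n A) (Polynomial.monomial j c) = c • rt L n A ^ j := by
        rw [← Polynomial.C_mul_X_pow_eq_monomial, map_mul, map_pow, AdjoinRoot.mk_X,
          AdjoinRoot.mk_C, Algebra.smul_def]
        rfl
      rw [this, ← TensorProduct.smul_tmul', TensorProduct.tmul_smul, mul_smul_comm, mul_smul_comm,
        h2]

theorem discr_mul_swap (z : TensorSq L n A) :
    discr L n A * swapTS L n A z = discr L n A * z := by
  induction z using TensorProduct.induction_on with
  | zero => simp
  | tmul a b =>
    have e1 : a ⊗ₜ[L] b = (a ⊗ₜ 1) * (1 ⊗ₜ b) := by simp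
    have e2 : b ⊗ₜ[L] a = (1 ⊗ₜ a) * (b ⊗ₜ 1) := by simp
    rw [Algebra.TensorProduct.comm_tmul, e1, e2, ← mul_assoc, ← mul_assoc, discr_mul_left,
      mul_right_comm, discr_mul_left, mul_right_comm]
  | add a b ha hb => rw [map_add, mul_add, mul_add, ha, hb]

/-- The ideal generated by the divided difference contains no antisymmetric elements. -/
theorem eq_zero_of_antisymm [CharZero L] {z : TensorSq L n A}
    (hz : z ∈ Ideal.span {discr L n A}) (h : swapTS L n A z = -z) : z = 0 := by
  -- Every multiple of the divided difference is symmetric, so antisymmetry gives `2z = 0`.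
  obtain ⟨w, rfl⟩ := Ideal.mem_span_singleton'.1 hz
  rw [map_mul, swap_discr, mul_comm, discr_mul_swap, mul_comm w, eq_neg_iff_add_eq_zero,
    ← two_smul L] at h
  rw [mul_comm]
  exact (smul_eq_zero.1 h).resolve_left two_ne_zero

/-- The elements `(u^i v - u v^i) / (u - v)`. -/
def twist : ℕ → TensorSq L n A
  -- For `i = 0` the quotient is `(v - u) / (u - v)`.
  | 0 => -1
  | i + 1 => ∑ j ∈ Finset.range i, (rt L n A ^ (j + 1)) ⊗ₜ (rt L n A ^ (i - j))

/-- This is the recursion that right multiplication by the triangular matrix of `K` imposes on the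
off-diagonal entries of its powers. -/
theorem twist_succ (i : ℕ) : twist L n A (i + 1) =
    (rt L n A ⊗ₜ 1) * twist L n A i + rt L n A ⊗ₜ (rt L n A ^ i) := by
  cases i with
  | zero => simp [twist]
  | succ i =>
    rw [twist, twist, Finset.sum_range_succ', Finset.mul_sum]
    simp [pow_succ']

theorem swap_twist (i : ℕ) : swapTS L n A (twist L n A i) = twist L n A i := by
  cases i with
  | zero => simp [twist]
  | succ i =>
    rw [twist, map_sum, ← Finset.sum_range_reflect]
    refine Finset.sum_congr rfl fun j hj => ?_
    rw [Finset.mem_range] at hj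
    rw [Algebra.TensorProduct.comm_tmul]
    congr 2 <;> omega

end TensorSquare

/-! ### The reflection equation in the generic principal series -/

section GenericSeries

variable {k 𝔷 T : Type*} [Field k] [CommRing 𝔷] [IsDomain 𝔷] [Algebra k 𝔷] [CommRing T]
  [Algebra k T] [Algebra 𝔷 T] [IsScalarTower k 𝔷 T] [Algebra (FieldXY 𝔷) T]
  [IsScalarTower k (FieldXY 𝔷) T] [IsScalarTower 𝔷 (FieldXY 𝔷) T]
  (q : k) {n : ℕ} {A : ℕ → 𝔷} (π : TensorSq (FieldXY 𝔷) n A →ₐ[FieldXY 𝔷] T)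

theorem map_aeval_left (f : 𝔷[X]) : Polynomial.aeval (π (rt _ n A ⊗ₜ 1)) f =
    π (Polynomial.aeval (rt _ n A) f ⊗ₜ 1) :=
  Polynomial.aeval_algHom_apply ((π.comp (Algebra.TensorProduct.includeLeft :
    RootAlg (FieldXY 𝔷) n A →ₐ[FieldXY 𝔷] TensorSq (FieldXY 𝔷) n A)).restrictScalars 𝔷)
    (rt _ n A) f

theorem map_aeval_right (f : 𝔷[X]) : Polynomial.aeval (π (1 ⊗ₜ rt _ n A)) f =
    π (1 ⊗ₜ Polynomial.aeval (rt _ n A) f) :=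
  Polynomial.aeval_algHom_apply ((π.comp (Algebra.TensorProduct.includeRight :
    RootAlg (FieldXY 𝔷) n A →ₐ[FieldXY 𝔷] TensorSq (FieldXY 𝔷) n A)).restrictScalars 𝔷)
    (rt _ n A) f

theorem map_smul_eq (a : FieldXY 𝔷) (z : TensorSq (FieldXY 𝔷) n A) :
    π (a • z) = algebraMap (FieldXY 𝔷) T a * π z := by
  rw [map_smul, Algebra.smul_def]

theorem dividedDiff_map (hd : π (discr (FieldXY 𝔷) n A) = 0) :
    dividedDiff (poly n A) (π (1 ⊗ₜ rt _ n A)) (π (rt _ n A ⊗ₜ 1)) = 0 :=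
  (map_dividedDiff (π.restrictScalars 𝔷) (poly n A) (1 ⊗ₜ rt _ n A)
    (rt _ n A ⊗ₜ 1)).symm.trans hd

variable (hπ : π (discr (FieldXY 𝔷) n A) = 0)

/-- The principal series representation with coefficients in a quotient of
`L[u, v] / (p(u), p(v))`, where `L = Frac 𝔷[x, y]`. -/
def genericSeries : Hp q (poly n A) →ₐ[𝔷] Matrix (Fin 2) (Fin 2) T :=
  principalSeries q (poly n A) (π (rt _ n A ⊗ₜ 1)) (π (1 ⊗ₜ rt _ n A))
    (by rw [map_aeval_left, aeval_rt, TensorProduct.zero_tmul, map_zero])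
    (by rw [map_aeval_right, aeval_rt, TensorProduct.tmul_zero, map_zero])
    (dividedDiff_map π hπ)

theorem genericSeries_genR' : genericSeries q π hπ (genR' q _) =
    !![0, 1; 1, omega T q] := by
  rw [genericSeries, principalSeries_genR']

theorem genericSeries_genK : genericSeries q π hπ (genK q _) =
    !![π (1 ⊗ₜ rt _ n A), -(omega T q * π (rt _ n A ⊗ₜ 1)); 0, π (rt _ n A ⊗ₜ 1)] := by
  rw [genericSeries, principalSeries_genK]

theorem genericSeries_pow (j : ℕ) : genericSeries q π hπ (genK q _ ^ j) =
    !![π (1 ⊗ₜ (rt _ n A ^ j)),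
        -(omega T q * (π (twist _ n A j) + π ((rt _ n A ^ j) ⊗ₜ 1)));
      0, π ((rt _ n A ^ j) ⊗ₜ 1)] := by
  induction j with
  | zero =>
    have h : (1 : RootAlg (FieldXY 𝔷) n A) ⊗ₜ[FieldXY 𝔷] (1 : RootAlg (FieldXY 𝔷) n A) = 1 := rfl
    simp only [pow_zero, map_one, h, twist, map_neg]
    rw [Matrix.one_fin_two]
    simp
  | succ j ih =>
    have e1 : (rt (FieldXY 𝔷) n A ^ (j + 1)) ⊗ₜ[FieldXY 𝔷] (1 : RootAlg (FieldXY 𝔷) n A) =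
        ((rt _ n A ^ j) ⊗ₜ 1) * (rt _ n A ⊗ₜ 1) := by simp [pow_succ]
    have e2 : (1 : RootAlg (FieldXY 𝔷) n A) ⊗ₜ[FieldXY 𝔷] (rt (FieldXY 𝔷) n A ^ (j + 1)) =
        (1 ⊗ₜ (rt _ n A ^ j)) * (1 ⊗ₜ rt _ n A) := by simp [pow_succ]
    have e3 : rt (FieldXY 𝔷) n A ⊗ₜ[FieldXY 𝔷] (rt (FieldXY 𝔷) n A ^ j) =
        (rt _ n A ⊗ₜ 1) * (1 ⊗ₜ (rt _ n A ^ j)) := by simp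
    rw [pow_succ, map_mul, ih, genericSeries_genK, Matrix.mul_fin_two, e1, e2, twist_succ, e3]
    simp only [map_mul, map_add]
    congr 1
    ext i l
    fin_cases i <;> fin_cases l
    · simp
    · simp
      ring
    · simp
    · simp

/-- Formally `ũ = A_n / u`, so `(ũ v - u ṽ) / (u - v) = -(ũ + ṽ)`. The off-diagonal entry is found
by solving `K K̃ = A_n`, which requires `v` to be a unit; this is where `A_n ≠ 0` enters. -/
theorem genericSeries_Ktilde (hA : A n ≠ 0) : genericSeries q π hπ (Ktilde q n A) =
    !![π (1 ⊗ₜ rtTilde _ n A),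
        -(omega T q * (-π (rtTilde _ n A ⊗ₜ 1 + 1 ⊗ₜ rtTilde _ n A) + π (rtTilde _ n A ⊗ₜ 1)));
      0, π (rtTilde _ n A ⊗ₜ 1)] := by
  have hut : π (rt _ n A ⊗ₜ 1) * π (rtTilde _ n A ⊗ₜ 1) = algebraMap 𝔷 T (A n) := by
    rw [rtTilde, ← map_aeval_left]
    apply mul_aeval_tildePoly
    rw [map_aeval_left, aeval_rt, TensorProduct.zero_tmul, map_zero]
  have hvt : π (1 ⊗ₜ rt _ n A) * π (1 ⊗ₜ rtTilde _ n A) = algebraMap 𝔷 T (A n) := by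
    rw [rtTilde, ← map_aeval_right]
    apply mul_aeval_tildePoly
    rw [map_aeval_right, aeval_rt, TensorProduct.tmul_zero, map_zero]
  have hau : IsUnit (algebraMap 𝔷 T (A n)) := by
    rw [IsScalarTower.algebraMap_apply 𝔷 (FieldXY 𝔷) T]
    refine IsUnit.map _ (IsUnit.mk0 _ ?_)
    rwa [Ne, map_eq_zero_iff _ (FaithfulSMul.algebraMap_injective 𝔷 (FieldXY 𝔷))]
  have hvu : IsUnit (π (1 ⊗ₜ rt _ n A)) := isUnit_of_mul_isUnit_left (hvt ▸ hau)
  have hK := genericSeries_genK q π hπ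
  have hT : genericSeries q π hπ (Ktilde q n A) =
      !![π (1 ⊗ₜ rtTilde _ n A), -(omega T q * π (rt _ n A ⊗ₜ 1)) *
        dividedDiff (tildePoly n A) (π (1 ⊗ₜ rt _ n A)) (π (rt _ n A ⊗ₜ 1));
        0, π (rtTilde _ n A ⊗ₜ 1)] := by
    rw [Ktilde_eq_aeval, ← Polynomial.aeval_algHom_apply, hK, aeval_triangular, map_aeval_left,
      map_aeval_right]
    rfl
  have hKT := congrArg (genericSeries q π hπ) (genK_mul_Ktilde q n A)
  rw [map_mul, hT, hK, Matrix.mul_fin_two, AlgHom.commutes, Matrix.algebraMap_eq_diagonal] at hKT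
  have h01 := congrFun (congrFun hKT 0) 1
  simp only [Matrix.of_apply, Matrix.cons_val', Matrix.cons_val_zero, Matrix.cons_val_one,
    Matrix.cons_val_fin_one, ne_eq, zero_ne_one, not_false_eq_true, Matrix.diagonal_apply_ne]
    at h01
  rw [hT, map_add]
  congr 4
  refine hvu.mul_left_cancel ?_
  linear_combination h01 + omega T q * (hut - hvt)

/-- The value at `K` of a polynomial with coefficients in `L`, written over
`1, K, ..., K^(n-1), K̃`, as an element of `L[u] / p(u)`. -/
def combo (L : Type*) [Field L] [Algebra 𝔷 L] (n : ℕ) (A : ℕ → 𝔷) (c : ℕ → L) (d : L) :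
    RootAlg L n A :=
  ∑ j ∈ Finset.range n, c j • rt L n A ^ j + d • rtTilde L n A

/-- The element `(F(u) v - u F(v)) / (u - v)`, up to multiples of the divided difference of
`p`. -/
def comboTwist (L : Type*) [Field L] [Algebra 𝔷 L] (n : ℕ) (A : ℕ → 𝔷) (c : ℕ → L) (d : L) :
    TensorSq L n A :=
  ∑ j ∈ Finset.range n, c j • twist L n A j -
    d • (rtTilde L n A ⊗ₜ 1 + 1 ⊗ₜ rtTilde L n A)

theorem extendRep_evalAt (hA : A n ≠ 0) (i : Fin 2) (c : ℕ → Zx k 𝔷) (d : Zx k 𝔷) :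
    extendRep (genericSeries q π hπ) (evalAt q (poly n A) i
      ((∑ j ∈ Finset.range n,
            scal q (poly n A) (c j) * const q (poly n A) (genK q (poly n A) ^ j)) +
          scal q (poly n A) d * const q (poly n A) (Ktilde q n A))) =
    !![π (1 ⊗ₜ combo _ n A (fun j => evalZx k 𝔷 i (c j)) (evalZx k 𝔷 i d)),
        -(omega T q *
          (π (comboTwist _ n A (fun j => evalZx k 𝔷 i (c j)) (evalZx k 𝔷 i d)) +
            π (combo _ n A (fun j => evalZx k 𝔷 i (c j)) (evalZx k 𝔷 i d) ⊗ₜ 1)));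
      0, π (combo _ n A (fun j => evalZx k 𝔷 i (c j)) (evalZx k 𝔷 i d) ⊗ₜ 1)] := by
  have hsum : ∀ (s : Finset ℕ) (f g h : ℕ → T),
      ∑ j ∈ s, !![f j, g j; 0, h j] = !![∑ j ∈ s, f j, ∑ j ∈ s, g j; 0, ∑ j ∈ s, h j] := by
    intro s f g h
    ext a b
    fin_cases a <;> fin_cases b <;> simp [Matrix.sum_apply]
  have hsm : ∀ a f g h : T, a • !![f, g; 0, h] = !![a * f, a * g; 0, a * h] := by
    intro a f g h
    ext a b
    fin_cases a <;> fin_cases b <;> simp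
  have hadd : ∀ a b c a' b' c' : T, !![a, b; 0, c] + !![a', b'; 0, c'] =
      !![a + a', b + b'; 0, c + c'] := by
    intro a b c a' b' c'
    ext a b
    fin_cases a <;> fin_cases b <;> simp
  simp only [map_add, map_sum, map_mul, extendRep_evalAt_scal, extendRep_evalAt_const,
    genericSeries_pow, genericSeries_Ktilde q π hπ hA, ← Algebra.smul_def, hsm, hsum, hadd]
  simp only [combo, comboTwist, TensorProduct.tmul_add, TensorProduct.add_tmul,
    TensorProduct.tmul_sum, TensorProduct.sum_tmul, TensorProduct.tmul_smul,
    ← TensorProduct.smul_tmul', map_add, map_sub, map_sum, map_smul_eq]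
  simp only [Algebra.smul_def]
  congr 4
  simp only [mul_add, mul_neg, Finset.sum_add_distrib, Finset.sum_neg_distrib, Finset.mul_sum,
    mul_sub, mul_left_comm (omega T q)]
  ring

/-- Lower left entry of the equation in the representation attached to `π`. It holds over any target
in which the divided difference dies, in particular over the quotient by it. -/
theorem map_reflection_identity (hd : π (discr (FieldXY 𝔷) n A) = 0) (hq : q - q⁻¹ ≠ 0)
    (hA : A n ≠ 0) (c : ℕ → Zx k 𝔷) (d : Zx k 𝔷)
    (hF : IsSolution q (poly n A) ((∑ j ∈ Finset.range n,
            scal q (poly n A) (c j) * const q (poly n A) (genK q (poly n A) ^ j)) +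
          scal q (poly n A) d * const q (poly n A) (Ktilde q n A)))
    {F G : RootAlg (FieldXY 𝔷) n A} {H : TensorSq (FieldXY 𝔷) n A}
    (hFx : F = combo _ n A (fun j => evalZx k 𝔷 0 (c j)) (evalZx k 𝔷 0 d))
    (hG : G = combo _ n A (fun j => evalZx k 𝔷 1 (c j)) (evalZx k 𝔷 1 d))
    (hH : H = comboTwist _ n A (fun j => evalZx k 𝔷 0 (c j)) (evalZx k 𝔷 0 d)) :
    π (((coord 𝔷 0 - coord 𝔷 1) * (coord 𝔷 0 * coord 𝔷 1 - 1)) • ((G ⊗ₜ 1 - 1 ⊗ₜ G) * H) +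
      (coord 𝔷 1 * (coord 𝔷 0 * coord 𝔷 1 - 1)) • (F ⊗ₜ G - G ⊗ₜ F) +
      (coord 𝔷 0 - coord 𝔷 1) • (1 ⊗ₜ (F * G) - (F * G) ⊗ₜ 1)) = 0 := by
  have h := congrArg (extendRep (genericSeries q π hd)) hF
  simp only [map_mul, extendRep_Rspec, extendRep_evalAt q π hd hA, genericSeries_genR',
    map_div₀, inclKxy_var] at h
  rw [← hFx, ← hG, ← hH] at h
  set x := coord 𝔷 0 with hx
  set y := coord 𝔷 1 with hy
  have hx0 : x ≠ 0 := coord_ne_zero 𝔷 0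
  have hy0 : y ≠ 0 := coord_ne_zero 𝔷 1
  have hw : algebraMap k (Matrix (Fin 2) (Fin 2) T) (q - q⁻¹) = omega T q • 1 := by
    rw [omega, algebraMap_smul, Algebra.algebraMap_eq_smul_one]
  simp only [hw] at h
  have hwu : IsUnit (omega T q) := (IsUnit.mk0 _ hq).map _
  -- The matrix entry is used with `r = y / x` and `s = 1 / (xy)`; the factor `x² y` makes all three
  -- coefficients polynomial.
  have c1 : (x - y) * (x * y - 1) = x ^ 2 * y * ((1 - (x / y)⁻¹) * (1 - (x * y)⁻¹)) := by
    field_simp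
  have c2 : y * (x * y - 1) = x ^ 2 * y * ((x / y)⁻¹ * (1 - (x * y)⁻¹)) := by
    field_simp
  have c3 : x - y = x ^ 2 * y * ((x * y)⁻¹ * (1 - (x / y)⁻¹)) := by
    field_simp
  have c1' := congrArg (algebraMap (FieldXY 𝔷) T) c1
  have c2' := congrArg (algebraMap (FieldXY 𝔷) T) c2
  have c3' := congrArg (algebraMap (FieldXY 𝔷) T) c3
  rw [map_mul _ (x ^ 2 * y), map_mul _ (1 - _) (1 - _), map_sub _ 1, map_sub _ 1, map_one] at c1'
  rw [map_mul _ (x ^ 2 * y), map_mul _ (x / y)⁻¹, map_sub _ 1, map_one] at c2'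
  rw [map_mul _ (x ^ 2 * y), map_mul _ (x * y)⁻¹, map_sub _ 1, map_one] at c3'
  have h' := reflection_entry hwu c1' c2' c3' h
  have e3 : F ⊗ₜ[FieldXY 𝔷] G = (F ⊗ₜ 1) * (1 ⊗ₜ G) := by simp
  have e4 : G ⊗ₜ[FieldXY 𝔷] F = (G ⊗ₜ 1) * (1 ⊗ₜ F) := by simp
  have e5 : (1 : RootAlg (FieldXY 𝔷) n A) ⊗ₜ[FieldXY 𝔷] (F * G) = (1 ⊗ₜ F) * (1 ⊗ₜ G) := by simp
  have e6 : (F * G) ⊗ₜ[FieldXY 𝔷] (1 : RootAlg (FieldXY 𝔷) n A) = (F ⊗ₜ 1) * (G ⊗ₜ 1) := by simp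
  rw [← h', e3, e4, e5, e6, map_add, map_add, map_smul_eq, map_smul_eq, map_smul_eq]
  simp only [map_mul π, map_sub π]

end GenericSeries

/-- The reflection equation, as an identity in `L[u, v] / (p(u), p(v))`. -/
theorem reflection_identity {k 𝔷 : Type*} [Field k] [CharZero k] [CommRing 𝔷] [IsDomain 𝔷]
    [Algebra k 𝔷] {q : k} {n : ℕ} {A : ℕ → 𝔷} (hq : q - q⁻¹ ≠ 0) (hA : A n ≠ 0)
    (c : ℕ → Zx k 𝔷) (d : Zx k 𝔷)
    (hF : IsSolution q (poly n A) ((∑ j ∈ Finset.range n,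
            scal q (poly n A) (c j) * const q (poly n A) (genK q (poly n A) ^ j)) +
          scal q (poly n A) d * const q (poly n A) (Ktilde q n A)))
    {F G : RootAlg (FieldXY 𝔷) n A} {H : TensorSq (FieldXY 𝔷) n A}
    (hFx : F = combo _ n A (fun j => evalZx k 𝔷 0 (c j)) (evalZx k 𝔷 0 d))
    (hG : G = combo _ n A (fun j => evalZx k 𝔷 1 (c j)) (evalZx k 𝔷 1 d))
    (hH : H = comboTwist _ n A (fun j => evalZx k 𝔷 0 (c j)) (evalZx k 𝔷 0 d)) :
    ((coord 𝔷 0 - coord 𝔷 1) * (coord 𝔷 0 * coord 𝔷 1 - 1)) • ((G ⊗ₜ 1 - 1 ⊗ₜ G) * H) +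
      (coord 𝔷 1 * (coord 𝔷 0 * coord 𝔷 1 - 1)) • (F ⊗ₜ G - G ⊗ₜ F) +
      (coord 𝔷 0 - coord 𝔷 1) • (1 ⊗ₜ (F * G) - (F * G) ⊗ₜ 1) = 0 := by
  have hc : CharZero (FieldXY 𝔷) :=
    charZero_of_injective_algebraMap (algebraMap k (FieldXY 𝔷)).injective
  apply eq_zero_of_antisymm
  · exact Ideal.Quotient.eq_zero_iff_mem.1 (map_reflection_identity q
      (Ideal.Quotient.mkₐ (FieldXY 𝔷) (Ideal.span {discr (FieldXY 𝔷) n A}))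
      (Ideal.Quotient.eq_zero_iff_mem.2 (Ideal.mem_span_singleton_self _)) hq hA c d hF hFx hG hH)
  -- Symmetry of `H` makes the first summand antisymmetric; the other two are visibly so.
  · have hHs : swapTS (FieldXY 𝔷) n A H = H := by
      rw [hH]
      simp [comboTwist, swap_twist, map_sum, add_comm]
    simp only [map_add, map_smul, map_mul, map_sub, hHs, Algebra.TensorProduct.comm_tmul]
    simp only [sub_mul, smul_sub, neg_add, neg_sub]

/-! ### Comparing coefficients -/

section Functionals

variable {𝔷 L : Type*} [CommRing 𝔷] [Field L] [Algebra 𝔷 L] {n : ℕ} {A : ℕ → 𝔷}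

/-- The functional `φ ⊗ ψ` on `L[u, v] / (p(u), p(v))`. -/
def pairFun (φ ψ : RootAlg L n A →ₗ[L] L) : TensorSq L n A →ₗ[L] L :=
  LinearMap.mul' L L ∘ₗ TensorProduct.map φ ψ

theorem pairFun_tmul (φ ψ : RootAlg L n A →ₗ[L] L) (a b : RootAlg L n A) :
    pairFun φ ψ (a ⊗ₜ b) = φ a * ψ b := by
  simp [pairFun]

/-- A solution has no powers of `K` between the first and the `(n-1)`-st one: the top one would
have a coefficient with vanishing square. -/
theorem top_coeff_mul_eq_zero {c c' : ℕ → L} {d d' p₁ p₂ p₃ : L} (hp₁ : p₁ ≠ 0)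
    (hE : p₁ • ((combo L n A c' d' ⊗ₜ 1 - 1 ⊗ₜ combo L n A c' d') * comboTwist L n A c d) +
      p₂ • (combo L n A c d ⊗ₜ combo L n A c' d' - combo L n A c' d' ⊗ₜ combo L n A c d) +
      p₃ • (1 ⊗ₜ (combo L n A c d * combo L n A c' d') -
        (combo L n A c d * combo L n A c' d') ⊗ₜ 1) = 0)
    {r : ℕ} (hr : 2 ≤ r) (hrn : r + 1 < n) (hc : ∀ j, r < j → j < n → c j = 0)
    (hc' : ∀ j, r < j → j < n → c' j = 0) : c r * c' r = 0 := by
  -- The coefficient of `u^(r+1) v^(r-1)` is read off. It arises only from `u^r` in `G(u)` times `u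
  -- v^(r-1)` in the twist of `K^r`. The bound `r + 1 < n` keeps `u^(r+1)` in the basis, and `2 ≤ r`
  -- makes both exponents positive, so `φ` and `ψ` kill `1`.
  obtain ⟨φ, hφt, hφ⟩ := exists_dual_pow L n A (r + 1)
  obtain ⟨ψ, hψt, hψ⟩ := exists_dual_pow L n A (r - 1)
  have hφ1 : φ 1 = 0 := by
    rw [← pow_zero (rt L n A), hφ 0 (by omega), if_neg (by omega)]
  have hψ1 : ψ 1 = 0 := by
    rw [← pow_zero (rt L n A), hψ 0 (by omega), if_neg (by omega)]
  have hcombo : ∀ (e : ℕ → L) (f : L), (∀ j, r < j → j < n → e j = 0) →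
      φ (combo L n A e f) = 0 := by
    intro e f he
    rw [combo, map_add, map_smul, hφt, smul_zero, add_zero, map_sum]
    refine Finset.sum_eq_zero fun j hj => ?_
    rw [Finset.mem_range] at hj
    rw [map_smul, hφ j hj]
    split_ifs with h
    · rw [he j (by omega) hj, zero_smul]
    · rw [smul_zero]
  have hF := hcombo c d hc
  have hG := hcombo c' d' hc'
  have hGrt : φ (combo L n A c' d' * rt L n A) = c' r := by
    rw [combo, add_mul, map_add, smul_mul_assoc, map_smul, mul_comm (rtTilde L n A),
      rt_mul_rtTilde, IsScalarTower.algebraMap_apply 𝔷 L, Algebra.algebraMap_eq_smul_one, map_smul,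
      hφ1, smul_zero, smul_zero, add_zero, Finset.sum_mul, map_sum,
      Finset.sum_eq_single_of_mem r (Finset.mem_range.2 (by omega))]
    · rw [smul_mul_assoc, ← pow_succ, map_smul, hφ _ hrn, if_pos rfl, smul_eq_mul, mul_one]
    · intro j hj hjr
      rw [Finset.mem_range] at hj
      rw [smul_mul_assoc, ← pow_succ, map_smul]
      by_cases hjn : j + 1 < n
      · rw [hφ _ hjn, if_neg (by omega), smul_zero]
      · rw [hc' j (by omega) hj, zero_smul]
  set G := combo L n A c' d' with hGdef
  have htwist : ∀ j, j ≤ r → pairFun φ ψ ((G ⊗ₜ 1 - 1 ⊗ₜ G) * twist L n A j) =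
      if j = r then c' r else 0 := by
    intro j hj
    cases j with
    | zero =>
      rw [if_neg (by omega), twist, mul_neg, mul_one, map_neg, map_sub, pairFun_tmul,
        pairFun_tmul, hG, hφ1]
      simp
    | succ i =>
      have hterm : ∀ l ∈ Finset.range i, pairFun φ ψ ((G ⊗ₜ 1 - 1 ⊗ₜ G) *
          ((rt L n A ^ (l + 1)) ⊗ₜ (rt L n A ^ (i - l)))) =
          φ (G * rt L n A ^ (l + 1)) * (if i - l = r - 1 then 1 else 0) := by
        intro l hl
        rw [Finset.mem_range] at hl
        rw [sub_mul, Algebra.TensorProduct.tmul_mul_tmul, Algebra.TensorProduct.tmul_mul_tmul,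
          map_sub, pairFun_tmul, pairFun_tmul, one_mul, one_mul, hφ (l + 1) (by omega),
          if_neg (by omega), zero_mul, sub_zero, hψ (i - l) (by omega)]
      rw [twist, Finset.mul_sum, map_sum, Finset.sum_congr rfl hterm]
      split_ifs with h
      · rw [Finset.sum_eq_single_of_mem 0 (Finset.mem_range.2 (by omega)), if_pos (by omega),
          mul_one, zero_add, pow_one, hGrt]
        intro l hl hl0
        rw [if_neg (by omega), mul_zero]
      · refine Finset.sum_eq_zero fun l hl => ?_
        rw [if_neg (by omega), mul_zero]
  have htilde : pairFun φ ψ ((G ⊗ₜ 1 - 1 ⊗ₜ G) *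
      (rtTilde L n A ⊗ₜ 1 + 1 ⊗ₜ rtTilde L n A)) = 0 := by
    simp only [sub_mul, mul_add, Algebra.TensorProduct.tmul_mul_tmul, map_sub, map_add,
      pairFun_tmul, one_mul, mul_one, hψ1, hφ1, hφt, hψt]
    ring
  have hH : pairFun φ ψ ((G ⊗ₜ 1 - 1 ⊗ₜ G) * comboTwist L n A c d) = c r * c' r := by
    rw [comboTwist, mul_sub, map_sub, mul_smul_comm, map_smul, htilde, smul_zero, sub_zero,
      Finset.mul_sum, map_sum, Finset.sum_eq_single_of_mem r (Finset.mem_range.2 (by omega))]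
    · rw [mul_smul_comm, map_smul, htwist r le_rfl, if_pos rfl, smul_eq_mul]
    · intro j hj hjr
      rw [Finset.mem_range] at hj
      rw [mul_smul_comm, map_smul]
      by_cases h : j ≤ r
      · rw [htwist j h, if_neg hjr, smul_zero]
      · rw [hc j (by omega) hj, zero_smul]
  have h := congrArg (pairFun φ ψ) hE
  rw [map_add, map_add, map_smul, map_smul, map_smul, hH, map_sub, map_sub, pairFun_tmul,
    pairFun_tmul, pairFun_tmul, pairFun_tmul, hF, hG, hφ1, hψ1] at h
  simpa [hp₁] using h

/-- The equations for the coefficients of a solution of the form `a K + b + d K̃`. -/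
theorem coeff_equations (hn : 2 ≤ n) {a b d a' b' d' p₁ p₂ p₃ : L}
    {F G : RootAlg L n A} {H : TensorSq L n A}
    (hF : F = a • rt L n A + b • 1 + d • rtTilde L n A)
    (hG : G = a' • rt L n A + b' • 1 + d' • rtTilde L n A)
    (hH : H = -(b • 1) - d • (rtTilde L n A ⊗ₜ 1 + 1 ⊗ₜ rtTilde L n A))
    (hE : p₁ • ((G ⊗ₜ 1 - 1 ⊗ₜ G) * H) + p₂ • (F ⊗ₜ G - G ⊗ₜ F) +
      p₃ • (1 ⊗ₜ (F * G) - (F * G) ⊗ₜ 1) = 0) :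
    -(p₁ * (a' * d)) + p₂ * (a * d' - a' * d) = 0 ∧
    ∀ φ : RootAlg L n A →ₗ[L] L, φ (rt L n A) = 0 →
      -((p₁ + p₃) * (d * d')) * (algebraMap 𝔷 L (A n) * φ (rtTilde L n A)) -
      p₃ * (a * a') * φ (rt L n A ^ 3) +
      (-(p₁ * (a' * b)) + p₂ * (a * b' - a' * b) - p₃ * (a * b' + a' * b)) * φ (rt L n A ^ 2) +
      (-(p₁ * (d' * b)) - p₂ * (b * d' - b' * d) - p₃ * (b * d' + b' * d)) *
        (algebraMap 𝔷 L (A n) * φ 1) = 0 := by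
  have hut : rt L n A * rtTilde L n A = algebraMap 𝔷 L (A n) • (1 : RootAlg L n A) := by
    rw [rt_mul_rtTilde, IsScalarTower.algebraMap_apply 𝔷 L, Algebra.algebraMap_eq_smul_one]
  constructor
  -- The coefficient of `u ⊗ ṽ`.
  · obtain ⟨φ, hφt, hφ⟩ := exists_dual_pow L n A 1
    obtain ⟨ψ, hψt, hψ⟩ := exists_dual_tilde L n A
    have hφ0 : φ 1 = 0 := by simpa using hφ 0 (by omega)
    have hφ1 : φ (rt L n A) = 1 := by simpa using hφ 1 (by omega)
    have hψ0 : ψ 1 = 0 := by simpa using hψ 0 (by omega)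
    have hψ1 : ψ (rt L n A) = 0 := by simpa using hψ 1 (by omega)
    have hφF : φ F = a := by simp [hF, hφ0, hφ1, hφt]
    have hφG : φ G = a' := by simp [hG, hφ0, hφ1, hφt]
    have hψF : ψ F = d := by simp [hF, hψ0, hψ1, hψt]
    have hψG : ψ G = d' := by simp [hG, hψ0, hψ1, hψt]
    have h := congrArg (pairFun φ ψ) hE
    simp only [hH, sub_mul, mul_sub, mul_add, mul_neg, mul_smul_comm, mul_one,
      Algebra.TensorProduct.tmul_mul_tmul, map_sub, map_add, map_neg, map_smul, pairFun_tmul,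
      one_mul, hφ0, hψ0, hφF, hψF, hφG, hψG, hφt, hψt, smul_eq_mul, map_zero] at h
    linear_combination h
  · intro φ' hφ'
    obtain ⟨ψ, hψt, hψ⟩ := exists_dual_pow L n A 0
    have hψ0 : ψ 1 = 1 := by simpa using hψ 0 (by omega)
    have hψ1 : ψ (rt L n A) = 0 := by simpa using hψ 1 (by omega)
    -- The first factor is multiplied by `u` before `φ'` is applied. Then `u ũ = A_n` removes one
    -- factor `ũ`, and `φ'(u) = 0` kills every term with `1` in the first slot. The second factor is
    -- tested against the functional dual to `1`.
    obtain ⟨φ, hφ⟩ : ∃ φ : RootAlg L n A →ₗ[L] L, ∀ z, φ z = φ' (rt L n A * z) :=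
      ⟨φ' ∘ₗ LinearMap.mulLeft L (rt L n A), fun _ => rfl⟩
    have hφ0 : φ 1 = 0 := by rw [hφ, mul_one, hφ']
    have hφ1 : φ (rt L n A) = φ' (rt L n A ^ 2) := by rw [hφ, sq]
    have hφ2 : φ (rt L n A * rt L n A) = φ' (rt L n A ^ 3) := by rw [hφ]; congr 1; ring
    have hφt : φ (rtTilde L n A) = algebraMap 𝔷 L (A n) * φ' 1 := by
      rw [hφ, hut, map_smul, smul_eq_mul]
    have hφtt : φ (rtTilde L n A * rtTilde L n A) =
        algebraMap 𝔷 L (A n) * φ' (rtTilde L n A) := by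
      rw [hφ, ← mul_assoc, hut, smul_mul_assoc, one_mul, map_smul, smul_eq_mul]
    have hψF : ψ F = b := by simp [hF, hψ0, hψ1, hψt]
    have hψG : ψ G = b' := by simp [hG, hψ0, hψ1, hψt]
    have hφF : φ F = a * φ (rt L n A) + d * φ (rtTilde L n A) := by simp [hF, hφ0]
    have hφG : φ G = a' * φ (rt L n A) + d' * φ (rtTilde L n A) := by simp [hG, hφ0]
    have hφut : φ (rt L n A * rtTilde L n A) = 0 := by rw [hut, map_smul, hφ0, smul_zero]
    have hφGt : φ (G * rtTilde L n A) =
        b' * φ (rtTilde L n A) + d' * φ (rtTilde L n A * rtTilde L n A) := by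
      simp only [hG, add_mul, smul_mul_assoc, one_mul, map_add, map_smul, hφut, smul_eq_mul]
      ring
    have hφFG : φ (F * G) = a * a' * φ (rt L n A * rt L n A) +
        (a * b' + b * a') * φ (rt L n A) + (b * d' + b' * d) * φ (rtTilde L n A) +
        d * d' * φ (rtTilde L n A * rtTilde L n A) := by
      simp only [hF, hG, add_mul, mul_add, smul_mul_assoc, mul_smul_comm, one_mul, mul_one,
        map_add, map_smul, hφut, mul_comm (rtTilde L n A) (rt L n A), hφ0, smul_eq_mul]
      ring
    have h := congrArg (pairFun φ ψ) hE
    simp only [hH, sub_mul, mul_sub, mul_add, mul_neg, mul_smul_comm, mul_one,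
      Algebra.TensorProduct.tmul_mul_tmul, map_sub, map_add, map_neg, map_smul, pairFun_tmul,
      one_mul, hφ0, hψ0, hφF, hψF, hφG, hψG, hφGt, hφFG, hψt, smul_eq_mul, map_zero] at h
    rw [hφ1, hφ2, hφt, hφtt] at h
    linear_combination h

end Functionals

/-! ### Shape, the restriction to `n = 3`, and uniqueness -/

section SmallSolutions

variable {k 𝔷 : Type*} [Field k] [CharZero k] [CommRing 𝔷] [IsDomain 𝔷] [Algebra k 𝔷] {q : k}
  {n : ℕ} {A : ℕ → 𝔷}

theorem evalZx_eq_zero {i : Fin 2} {e : Zx k 𝔷} (h : evalZx k 𝔷 i e = 0) : e = 0 :=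
  (map_eq_zero_iff _ (evalZx_injective k 𝔷 i)).1 h

theorem evalZx_mul_eq_zero {e : Zx k 𝔷} (h : evalZx k 𝔷 0 e * evalZx k 𝔷 1 e = 0) : e = 0 :=
  (mul_eq_zero.1 h).elim evalZx_eq_zero evalZx_eq_zero

theorem sum_range_eq_of_two_le {M : Type*} [AddCommMonoid M] (hn : 2 ≤ n) {f : ℕ → M}
    (hf : ∀ j, 2 ≤ j → j < n → f j = 0) : ∑ j ∈ Finset.range n, f j = f 0 + f 1 := by
  rw [← Finset.sum_subset (Finset.range_subset_range.2 hn)]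
  · rw [Finset.sum_range_succ, Finset.sum_range_one]
  · intro j hj hj2
    exact hf j (not_lt.1 fun h => hj2 (Finset.mem_range.2 h)) (Finset.mem_range.1 hj)

/-- The shape of a small solution, together with the equations for its coefficients. -/
theorem IsSmallSolution.shape (hq : q - q⁻¹ ≠ 0) (hA : A n ≠ 0) {F : Hpx q (poly n A)}
    (hF : IsSmallSolution q n A F) : 2 ≤ n ∧ ∃ a b d : Zx k 𝔷, (n = 2 → a = 0) ∧
      F = scal q (poly n A) a * const q (poly n A) (genK q (poly n A)) + scal q (poly n A) b +
        scal q (poly n A) d * const q (poly n A) (Ktilde q n A) ∧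
      -(((coord 𝔷 0 - coord 𝔷 1) * (coord 𝔷 0 * coord 𝔷 1 - 1)) *
          (evalZx k 𝔷 1 a * evalZx k 𝔷 0 d)) +
        (coord 𝔷 1 * (coord 𝔷 0 * coord 𝔷 1 - 1)) *
          (evalZx k 𝔷 0 a * evalZx k 𝔷 1 d - evalZx k 𝔷 1 a * evalZx k 𝔷 0 d) = 0 ∧
      ∀ φ : RootAlg (FieldXY 𝔷) n A →ₗ[FieldXY 𝔷] FieldXY 𝔷, φ (rt _ n A) = 0 →
        -(((coord 𝔷 0 - coord 𝔷 1) * (coord 𝔷 0 * coord 𝔷 1 - 1) + (coord 𝔷 0 - coord 𝔷 1)) *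
          (evalZx k 𝔷 0 d * evalZx k 𝔷 1 d)) *
          (algebraMap 𝔷 (FieldXY 𝔷) (A n) * φ (rtTilde _ n A)) -
        (coord 𝔷 0 - coord 𝔷 1) * (evalZx k 𝔷 0 a * evalZx k 𝔷 1 a) * φ (rt _ n A ^ 3) +
        (-(((coord 𝔷 0 - coord 𝔷 1) * (coord 𝔷 0 * coord 𝔷 1 - 1)) *
            (evalZx k 𝔷 1 a * evalZx k 𝔷 0 b)) +
          (coord 𝔷 1 * (coord 𝔷 0 * coord 𝔷 1 - 1)) *
            (evalZx k 𝔷 0 a * evalZx k 𝔷 1 b - evalZx k 𝔷 1 a * evalZx k 𝔷 0 b) -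
          (coord 𝔷 0 - coord 𝔷 1) *
            (evalZx k 𝔷 0 a * evalZx k 𝔷 1 b + evalZx k 𝔷 1 a * evalZx k 𝔷 0 b)) *
          φ (rt _ n A ^ 2) +
        (-(((coord 𝔷 0 - coord 𝔷 1) * (coord 𝔷 0 * coord 𝔷 1 - 1)) *
            (evalZx k 𝔷 1 d * evalZx k 𝔷 0 b)) -
          (coord 𝔷 1 * (coord 𝔷 0 * coord 𝔷 1 - 1)) *
            (evalZx k 𝔷 0 b * evalZx k 𝔷 1 d - evalZx k 𝔷 1 b * evalZx k 𝔷 0 d) -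
          (coord 𝔷 0 - coord 𝔷 1) *
            (evalZx k 𝔷 0 b * evalZx k 𝔷 1 d + evalZx k 𝔷 1 b * evalZx k 𝔷 0 d)) *
          (algebraMap 𝔷 (FieldXY 𝔷) (A n) * φ 1) = 0 := by
  obtain ⟨hs, hn, c, d, rfl, hcn⟩ := hF
  have hE := reflection_identity hq hA c d hs rfl rfl rfl
  have hp₁ : (coord 𝔷 0 - coord 𝔷 1) * (coord 𝔷 0 * coord 𝔷 1 - 1) ≠ 0 :=
    mul_ne_zero (sub_ne_zero.2 (coord_zero_ne_coord_one 𝔷))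
      (sub_ne_zero.2 (coord_mul_coord_ne_one 𝔷))
  -- Descending induction on `j`, with `m` bounding `n - j`. It starts from smallness, `c (n - 1) =
  -- 0`; below that the product of the values of `c j` at `x` and `y` vanishes.
  have hc : ∀ m j, 2 ≤ j → j < n → n ≤ j + m → c j = 0 := by
    intro m
    induction m with
    | zero => intro j _ h h'; omega
    | succ m ih =>
      intro j hj hjn hjm
      by_cases hj1 : j + 1 = n
      · rw [← hcn, ← hj1, Nat.add_sub_cancel]
      · refine evalZx_mul_eq_zero (top_coeff_mul_eq_zero hp₁ hE hj (by omega) ?_ ?_) <;>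
        · intro l hl hln
          rw [ih l (by omega) hln (by omega), map_zero]
  have hc' : ∀ j, 2 ≤ j → j < n → c j = 0 := fun j hj hjn => hc n j hj hjn (by omega)
  have hcombo (i : Fin 2) : combo _ n A (fun j => evalZx k 𝔷 i (c j)) (evalZx k 𝔷 i d) =
      evalZx k 𝔷 i (c 1) • rt _ n A + evalZx k 𝔷 i (c 0) • 1 +
        evalZx k 𝔷 i d • rtTilde _ n A := by
    rw [combo, sum_range_eq_of_two_le hn, pow_zero, pow_one, add_comm (_ • (1 : RootAlg _ n A))]
    intro j hj hjn
    rw [hc' j hj hjn, map_zero, zero_smul]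
  have htwist : comboTwist _ n A (fun j => evalZx k 𝔷 0 (c j)) (evalZx k 𝔷 0 d) =
      -(evalZx k 𝔷 0 (c 0) • 1) -
        evalZx k 𝔷 0 d • (rtTilde _ n A ⊗ₜ 1 + 1 ⊗ₜ rtTilde _ n A) := by
    rw [comboTwist, sum_range_eq_of_two_le hn]
    · simp [twist]
    · intro j hj hjn
      rw [hc' j hj hjn, map_zero, zero_smul]
  refine ⟨hn, c 1, c 0, d, ?_, ?_, coeff_equations hn (hcombo 0) (hcombo 1) htwist hE⟩
  · rintro rfl
    exact hcn
  · rw [sum_range_eq_of_two_le hn, pow_zero, pow_one, map_one, mul_one,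
      add_comm (scal q (poly n A) (c 0))]
    intro j hj hjn
    rw [hc' j hj hjn, map_zero, zero_mul]

/-- A non-trivial small solution exists only for `n = 3`. -/
theorem IsNontrivialSmall.eq_three (hq : q - q⁻¹ ≠ 0) (hA : A n ≠ 0) {F : Hpx q (poly n A)}
    (hF : IsNontrivialSmall q n A F) : n = 3 := by
  obtain ⟨hn, a, b, d, ha2, hFeq, -, hE⟩ := hF.1.shape hq hA
  by_contra hn3
  have hxy : coord 𝔷 0 - coord 𝔷 1 ≠ 0 := sub_ne_zero.2 (coord_zero_ne_coord_one 𝔷)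
  have hAn : algebraMap 𝔷 (FieldXY 𝔷) (A n) ≠ 0 := by
    rwa [Ne, map_eq_zero_iff _ (FaithfulSMul.algebraMap_injective 𝔷 (FieldXY 𝔷))]
  have hd : d = 0 := by
    obtain ⟨φ, hφt, hφ⟩ := exists_dual_tilde (FieldXY 𝔷) n A
    have h0 : φ 1 = 0 := by simpa using hφ 0 (by omega)
    have h1 : φ (rt _ n A) = 0 := by simpa using hφ 1 (by omega)
    have h := hE φ h1
    have hz : (coord 𝔷 0 - coord 𝔷 1) * (coord 𝔷 0 * coord 𝔷 1) *
        algebraMap 𝔷 (FieldXY 𝔷) (A n) * (evalZx k 𝔷 0 d * evalZx k 𝔷 1 d) = 0 := by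
      -- The `K̃`-coordinate isolates `d(x) d(y)`, with factor `(x - y)(xy - 1) + (x - y) = (x - y)
      -- xy`. The competing term `a(x) a(y) u³` has no such coordinate for `n > 3`. For `n = 2`
      -- smallness gives `a = c 1 = 0`.
      rcases Nat.lt_or_ge 3 n with h3 | h3
      · rw [hφt, h0, hφ 2 (by omega), hφ 3 h3] at h
        linear_combination -h
      · rw [ha2 (by omega), hφt, h0, map_zero, map_zero] at h
        linear_combination -h
    refine evalZx_mul_eq_zero ((mul_eq_zero.1 hz).resolve_left ?_)
    exact mul_ne_zero (mul_ne_zero hxy (mul_ne_zero (coord_ne_zero 𝔷 0) (coord_ne_zero 𝔷 1))) hAn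
  have ha : a = 0 := by
    rcases Nat.lt_or_ge 3 n with h3 | h3
    · obtain ⟨φ, hφt, hφ⟩ := exists_dual_pow (FieldXY 𝔷) n A 3
      have h0 : φ 1 = 0 := by simpa using hφ 0 (by omega)
      have h1 : φ (rt _ n A) = 0 := by simpa using hφ 1 (by omega)
      have h := hE φ h1
      rw [hφt, h0, hφ 2 (by omega), hφ 3 h3, if_pos rfl, if_neg (by omega), hd, map_zero] at h
      refine evalZx_mul_eq_zero ((mul_eq_zero.1 (?_ : (coord 𝔷 0 - coord 𝔷 1) * _ = 0)).resolve_left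
        hxy)
      linear_combination -h
    · exact ha2 (by omega)
  refine hF.2 ⟨b, ?_⟩
  rw [hFeq, ha, hd, map_zero]
  simp

/-- The solution of the equations for the coefficients for `n = 3`. -/
theorem coeff_equations_three {L : Type*} [Field L] {x y a b d a' b' d' A₀ A₂ A₃ s : L}
    (hx : x ≠ 0) (hxy : x ≠ y) (hxy1 : x * y ≠ 1) (hy : y ≠ 0) (hA : A₃ ≠ 0) (hs : s ^ 2 = -A₃)
    (hd : d ≠ 0) (hd' : d' ≠ 0)
    (h₁ : -(((x - y) * (x * y - 1)) * (a' * d)) + (y * (x * y - 1)) * (a * d' - a' * d) = 0)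
    (h₂ : (x - y) * (x * y * (d * d') * A₃ + a * a') = 0)
    (h₃ : -(((x - y) * (x * y - 1)) * (a' * b)) + (y * (x * y - 1)) * (a * b' - a' * b) -
      (x - y) * (a * b' + a' * b) = (x - y) * (a * a') * A₀)
    (h₄ : (-(((x - y) * (x * y - 1)) * (d' * b)) - (y * (x * y - 1)) * (b * d' - b' * d) -
      (x - y) * (b * d' + b' * d)) * A₃ = (x - y) * (a * a') * A₂) :
    ∃ e, (e = s ∨ e = -s) ∧ a' = e * y * d' ∧ b' * (y ^ 2 - 1) = d' * (A₀ * e + A₂ * y) * y := by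
  have hxy' : x - y ≠ 0 := sub_ne_zero.2 hxy
  -- The quotient `a / (x d)` is the same at `x` and at `y`; with `e₂` its square must be `-A₃`.
  have e₁ : y * a * d' = x * a' * d := by
    refine mul_left_cancel₀ (sub_ne_zero.2 hxy1) ?_
    linear_combination h₁
  have e₂ : x * y * (d * d') * A₃ + a * a' = 0 := (mul_eq_zero.1 h₂).resolve_left hxy'
  have e₃ : a' ^ 2 = (s * y * d') ^ 2 := by
    refine mul_left_cancel₀ (mul_ne_zero hx hd) ?_
    linear_combination -a' * e₁ + y * d' * e₂ - x * d * y ^ 2 * d' ^ 2 * hs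
  obtain ⟨e, he, ha'⟩ : ∃ e, (e = s ∨ e = -s) ∧ a' = e * y * d' := by
    rcases sq_eq_sq_iff_eq_or_eq_neg.1 e₃ with h | h
    · exact ⟨s, Or.inl rfl, h⟩
    · exact ⟨-s, Or.inr rfl, by rw [h]; ring⟩
  refine ⟨e, he, ha', ?_⟩
  have hes : e ^ 2 = -A₃ := by rcases he with rfl | rfl <;> linear_combination hs
  have he0 : e ≠ 0 := by
    rintro rfl
    apply hA
    linear_combination hes
  have ha : a = e * x * d := by
    refine mul_left_cancel₀ (mul_ne_zero hy hd') ?_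
    rw [ha'] at e₁
    linear_combination e₁
  subst ha ha'
  have e₄ : -(y ^ 2 * (x ^ 2 - 1)) * (d' * b) + x ^ 2 * (y ^ 2 - 1) * (d * b') =
      (x - y) * e * x * y * (d * d') * A₀ := by
    refine mul_left_cancel₀ he0 ?_
    linear_combination h₃
  have e₅ : y * (x ^ 2 - 1) * (d' * b) - x * (y ^ 2 - 1) * (d * b') =
      (x - y) * x * y * (d * d') * A₂ := by
    refine mul_left_cancel₀ (neg_ne_zero.2 hA) ?_
    linear_combination h₄ + (x - y) * x * y * (d * d') * A₂ * hes
  -- In `e₄ + y e₅` the terms with `b` cancel, leaving an equation for `b'` alone.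
  refine mul_left_cancel₀ (mul_ne_zero (mul_ne_zero hx hd) hxy') ?_
  linear_combination e₄ + y * e₅

theorem evalZx_smallCoeff (i : Fin 2) (a₀ a₂ : 𝔷) :
    evalZx k 𝔷 i (a₀ ⊗ₜ[k] (1 / (RatFunc.X - RatFunc.X⁻¹)) +
        a₂ ⊗ₜ[k] (RatFunc.X / (RatFunc.X - RatFunc.X⁻¹))) * (coord 𝔷 i ^ 2 - 1) =
      (algebraMap 𝔷 _ a₀ + algebraMap 𝔷 _ a₂ * coord 𝔷 i) * coord 𝔷 i := by
  have hy := coord_ne_zero 𝔷 i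
  have hy2 : coord 𝔷 i ^ 2 - 1 ≠ 0 := sub_ne_zero.2 (coord_sq_ne_one 𝔷 i)
  rw [map_add, evalZx_tmul, evalZx_tmul]
  simp only [map_div₀, map_sub, map_inv₀, map_one, subst_X, inclKxy_var]
  have h : coord 𝔷 i - (coord 𝔷 i)⁻¹ = (coord 𝔷 i ^ 2 - 1) / coord 𝔷 i := by
    field_simp
  rw [h]
  field_simp

/-- Uniqueness of the non-trivial small solution up to a factor and a sign. -/
theorem IsNontrivialSmall.eq_smul (hq : q - q⁻¹ ≠ 0) (hA : A 3 ≠ 0) {F : Hpx q (poly 3 A)}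
    (hF : IsNontrivialSmall q 3 A F) {s : 𝔷} (hs : s ^ 2 = -A 3) : ∃ f : Zx k 𝔷,
      F = scal q (poly 3 A) f * smallFormula q 3 A s (Ktilde q 3 A) ∨
      F = scal q (poly 3 A) f * smallFormula q 3 A (-s) (Ktilde q 3 A) := by
  obtain ⟨hn, a, b, d, -, hFeq, h₁, hE⟩ := hF.1.shape hq hA
  have hAn : algebraMap 𝔷 (FieldXY 𝔷) (A 3) ≠ 0 := by
    rwa [Ne, map_eq_zero_iff _ (FaithfulSMul.algebraMap_injective 𝔷 (FieldXY 𝔷))]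
  -- For `n = 3` the cube is no longer a basis element. Its `K̃`-, `K²`- and constant coordinates
  -- `1`, `A₀`, `A₂` are what enter `h₂`, `h₃` and `h₄`.
  have hcube : rt (FieldXY 𝔷) 3 A ^ 3 = rtTilde _ 3 A +
      algebraMap 𝔷 (FieldXY 𝔷) (A 0) • rt _ 3 A ^ 2 +
      algebraMap 𝔷 (FieldXY 𝔷) (A 1) • rt _ 3 A + algebraMap 𝔷 (FieldXY 𝔷) (A 2) • 1 := by
    rw [rtTilde_eq, Finset.sum_range_succ, Finset.sum_range_succ, Finset.sum_range_one]
    simp only [Nat.sub_self, pow_zero, Nat.sub_zero, Nat.add_one_sub_one, pow_one]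
    abel
  have h₂ : (coord 𝔷 0 - coord 𝔷 1) * (coord 𝔷 0 * coord 𝔷 1 *
      (evalZx k 𝔷 0 d * evalZx k 𝔷 1 d) * algebraMap 𝔷 (FieldXY 𝔷) (A 3) +
      evalZx k 𝔷 0 a * evalZx k 𝔷 1 a) = 0 := by
    obtain ⟨φ, hφt, hφ⟩ := exists_dual_tilde (FieldXY 𝔷) 3 A
    have h0 : φ 1 = 0 := by simpa using hφ 0 (by omega)
    have h1 : φ (rt _ 3 A) = 0 := by simpa using hφ 1 (by omega)
    have h3 : φ (rt _ 3 A ^ 3) = 1 := by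
      rw [hcube]
      simp [h0, h1, hφt, hφ 2 (by omega)]
    have h := hE φ h1
    rw [hφt, h0, hφ 2 (by omega), h3] at h
    linear_combination -h
  obtain ⟨φ₂, hφ₂t, hφ₂⟩ := exists_dual_pow (FieldXY 𝔷) 3 A 2
  have h20 : φ₂ 1 = 0 := by simpa using hφ₂ 0 (by omega)
  have h21 : φ₂ (rt _ 3 A) = 0 := by simpa using hφ₂ 1 (by omega)
  have h22 : φ₂ (rt _ 3 A ^ 2) = 1 := by simpa using hφ₂ 2 (by omega)
  have h23 : φ₂ (rt _ 3 A ^ 3) = algebraMap 𝔷 (FieldXY 𝔷) (A 0) := by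
    simp only [hcube, map_add, map_smul, h20, h21, h22, hφ₂t, smul_eq_mul, mul_zero, mul_one,
      add_zero, zero_add]
  have h₃ := hE φ₂ h21
  rw [hφ₂t, h20, h22, h23] at h₃
  obtain ⟨φ₀, hφ₀t, hφ₀⟩ := exists_dual_pow (FieldXY 𝔷) 3 A 0
  have h00 : φ₀ 1 = 1 := by simpa using hφ₀ 0 (by omega)
  have h01 : φ₀ (rt _ 3 A) = 0 := by simpa using hφ₀ 1 (by omega)
  have h02 : φ₀ (rt _ 3 A ^ 2) = 0 := by simpa using hφ₀ 2 (by omega)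
  have h03 : φ₀ (rt _ 3 A ^ 3) = algebraMap 𝔷 (FieldXY 𝔷) (A 2) := by
    simp only [hcube, map_add, map_smul, h00, h01, h02, hφ₀t, smul_eq_mul, mul_zero, mul_one,
      add_zero, zero_add]
  have h₄ := hE φ₀ h01
  rw [hφ₀t, h00, h02, h03] at h₄
  have hd : d ≠ 0 := by
    rintro rfl
    have ha : a = 0 := by
      refine evalZx_mul_eq_zero ((mul_eq_zero.1 h₂).resolve_left
        (sub_ne_zero.2 (coord_zero_ne_coord_one 𝔷)) |> fun h => ?_)
      rw [map_zero] at h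
      linear_combination h
    refine hF.2 ⟨b, ?_⟩
    rw [hFeq, ha, map_zero]
    simp
  have hd0 : ∀ i, evalZx k 𝔷 i d ≠ 0 := fun i h => hd (evalZx_eq_zero h)
  have hsL : algebraMap 𝔷 (FieldXY 𝔷) s ^ 2 = -algebraMap 𝔷 (FieldXY 𝔷) (A 3) := by
    rw [← map_pow, hs, map_neg]
  obtain ⟨e, he, ha', hb'⟩ := coeff_equations_three (coord_ne_zero 𝔷 0)
    (coord_zero_ne_coord_one 𝔷) (coord_mul_coord_ne_one 𝔷) (coord_ne_zero 𝔷 1) hAn hsL (hd0 0)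
    (hd0 1) h₁ h₂ (A₀ := algebraMap 𝔷 _ (A 0)) (A₂ := algebraMap 𝔷 _ (A 2))
    (b := evalZx k 𝔷 0 b) (b' := evalZx k 𝔷 1 b)
    (by linear_combination h₃) (by linear_combination h₄)
  -- The factor `f` is the coefficient `d` of `K̃`. Identities for `a` and `b` at the coordinate `y`
  -- suffice, by injectivity of that evaluation.
  have key : ∀ r : 𝔷, e = algebraMap 𝔷 _ r →
      F = scal q (poly 3 A) d * smallFormula q 3 A r (Ktilde q 3 A) := by
    rintro r rfl
    have ha : a = d * (r ⊗ₜ[k] RatFunc.X) := by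
      apply evalZx_injective k 𝔷 1
      rw [ha', map_mul, evalZx_tmul, subst_X, inclKxy_var]
      ring
    have hb : b = d * ((A 0 * r) ⊗ₜ[k] (1 / (RatFunc.X - RatFunc.X⁻¹)) +
        A 2 ⊗ₜ[k] (RatFunc.X / (RatFunc.X - RatFunc.X⁻¹))) := by
      apply evalZx_injective k 𝔷 1
      refine mul_right_cancel₀ (sub_ne_zero.2 (coord_sq_ne_one 𝔷 1)) ?_
      rw [hb', map_mul, mul_assoc (evalZx k 𝔷 1 d) _ (_ - _), evalZx_smallCoeff, map_mul]
      ring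
    rw [hFeq, smallFormula, ha, hb, map_mul, map_mul]
    simp only [mul_add, mul_assoc]
  rcases he with rfl | rfl
  · exact ⟨d, Or.inl (key s rfl)⟩
  · exact ⟨d, Or.inr (key (-s) (map_neg _ _).symm)⟩

end SmallSolutions

/-! ### Exchange relations and the explicit solution -/

section Existence

variable {Z H : Type*} [CommRing Z] [Ring H] [Algebra Z H] {w : Z} {R K t : H}

/-- Exchange relation of `R K̃ R` with `K`. -/
theorem conj_mul_K (hR : R * R = w • R + 1) (ht : Commute (R * K * R) t) :
    R * t * R * K = K * R * t * R + w • (t * R * K - K * R * t) := by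
  have h1 : (R - w • 1) * R = 1 := by
    rw [sub_mul, hR, smul_mul_assoc, one_mul, add_sub_cancel_left]
  have h2 : R * (R - w • 1) = 1 := by
    rw [mul_sub, hR, mul_smul_comm, mul_one, add_sub_cancel_left]
  -- With `R⁻¹ = R - w`, both sides equal `R⁻¹ (t · R K R) R⁻¹`, since `t` commutes with `R K R`.
  have h3 : (R - w • 1) * t * R * K = K * R * t * (R - w • 1) := by
    calc (R - w • 1) * t * R * K = (R - w • 1) * (t * (R * K * R)) * (R - w • 1) := by
          rw [mul_assoc _ (t * _) _, mul_assoc t, mul_assoc (R * K), h2]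
          simp only [mul_assoc, mul_one]
      _ = (R - w • 1) * R * (K * R * t * (R - w • 1)) := by
          rw [← ht.eq]
          simp only [mul_assoc]
      _ = _ := by rw [h1, one_mul]
  have h4 : (R - w • 1) * t * R * K = R * t * R * K - w • (t * R * K) := by
    simp only [sub_mul, smul_mul_assoc, one_mul]
  have h5 : K * R * t * (R - w • 1) = K * R * t * R - w • (K * R * t) := by
    simp only [mul_sub, mul_smul_comm, mul_one]
  rw [h4, h5] at h3
  rw [sub_eq_iff_eq_add.1 h3, smul_sub]
  abel

variable {A₀ A₁ A₂ A₃ : Z}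

theorem commute_conj_tilde (hRK : R * K * R * K = K * R * K * R)
    (ht : t = K * K * K - A₀ • (K * K) - A₁ • K - A₂ • 1) : Commute (R * K * R) t := by
  have hJ : Commute (R * K * R) K := by
    rw [Commute, SemiconjBy, hRK]
    simp only [mul_assoc]
  rw [ht]
  exact (((hJ.mul_right hJ).mul_right hJ).sub_right ((hJ.mul_right hJ).smul_right _)).sub_right
    (hJ.smul_right _) |>.sub_right ((Commute.one_right _).smul_right _)

/-- Expanding one factor of `t²` as a cubic in `K` and using `t K = A₃` makes `t²` a linear
combination of `K²`, `K`, `1` and `t`. -/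
theorem comm_tilde_sq (htK : t * K = A₃ • 1)
    (ht : t = K * K * K - A₀ • (K * K) - A₁ • K - A₂ • 1) :
    R * t * t - t * t * R = A₃ • (R * (K * K) - K * K * R) -
      (A₀ * A₃) • (R * K - K * R) - A₂ • (R * t - t * R) := by
  have htt : t * t = A₃ • (K * K) - (A₀ * A₃) • K - (A₁ * A₃) • 1 - A₂ • t := by
    have e : t * t = t * (K * K * K - A₀ • (K * K) - A₁ • K - A₂ • 1) := congrArg (t * ·) ht
    rw [e]
    simp only [mul_sub, mul_smul_comm, ← mul_assoc, htK, smul_mul_assoc, one_mul, mul_one]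
    module
  rw [mul_assoc, htt]
  simp only [mul_sub, sub_mul, mul_smul_comm, smul_mul_assoc, mul_one, one_mul]
  module

/-- Exchange relation of `R K̃ R` with `K̃`. -/
theorem conj_mul_tilde (hR : R * R = w • R + 1) (hRK : R * K * R * K = K * R * K * R)
    (hKt : K * t = A₃ • 1) (htK : t * K = A₃ • 1)
    (ht : t = K * K * K - A₀ • (K * K) - A₁ • K - A₂ • 1) :
    R * t * R * t = t * R * t * R + w • (R * t * t - t * t * R) := by
  have hJt := commute_conj_tilde hRK ht
  -- `X` is moved past `K`, `K²` and `K³` in turn, and the results are combined according to the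
  -- cubic expression of `t`. Products of adjacent `K` and `t` collapse to `A₃`.
  obtain ⟨X, hX⟩ : ∃ X, X = R * t * R := ⟨_, rfl⟩
  have x1 : X * K = K * X + w • (t * R * K - K * R * t) := by
    rw [hX, conj_mul_K hR hJt]
    simp only [mul_assoc]
  have x2 : X * (K * K) = K * K * X + w • (t * R * (K * K) - K * K * R * t +
      A₃ • (R * K - K * R)) := by
    have e1 : K * R * t * K = A₃ • (K * R) := by
      rw [mul_assoc, htK, mul_smul_comm, mul_one]
    have e2 : K * (t * R * K) = A₃ • (R * K) := by
      rw [← mul_assoc, ← mul_assoc, hKt, smul_mul_assoc, one_mul, smul_mul_assoc]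
    calc X * (K * K) = (K * X + w • (t * R * K - K * R * t)) * K := by rw [← x1, mul_assoc]
      _ = K * (X * K) + w • (t * R * (K * K) - K * R * t * K) := by
          simp only [add_mul, sub_mul, smul_mul_assoc, mul_assoc]
      _ = K * K * X + w • (K * (t * R * K) - K * K * R * t) +
            w • (t * R * (K * K) - K * R * t * K) := by
          rw [x1]
          simp only [mul_add, mul_sub, mul_smul_comm, mul_assoc]
      _ = _ := by
          rw [e1, e2]
          module
  have x3 : X * (K * K * K) = K * K * K * X + w • (t * R * (K * K * K) - K * K * K * R * t +
      A₃ • (R * (K * K) - K * K * R)) := by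
    have e1 : K * K * R * t * K = A₃ • (K * K * R) := by
      rw [mul_assoc, htK, mul_smul_comm, mul_one]
    have e2 : K * K * (t * R * K) = A₃ • (K * R * K) := by
      rw [← mul_assoc, ← mul_assoc, mul_assoc K K t, hKt, mul_smul_comm, mul_one, smul_mul_assoc,
        smul_mul_assoc]
    calc X * (K * K * K) = (K * K * X + w • (t * R * (K * K) - K * K * R * t +
          A₃ • (R * K - K * R))) * K := by rw [← x2, mul_assoc X]
      _ = K * K * (X * K) + w • (t * R * (K * K * K) - K * K * R * t * K +
          A₃ • (R * (K * K) - K * R * K)) := by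
          simp only [add_mul, sub_mul, smul_mul_assoc, mul_assoc]
      _ = K * K * K * X + w • (K * K * (t * R * K) - K * K * K * R * t) +
          w • (t * R * (K * K * K) - K * K * R * t * K + A₃ • (R * (K * K) - K * R * K)) := by
          rw [x1]
          simp only [mul_add, mul_sub, mul_smul_comm, mul_assoc]
      _ = _ := by
          rw [e1, e2]
          module
  have hK3 : K * K * K = t + A₀ • (K * K) + A₁ • K + A₂ • 1 := by
    rw [ht]
    abel
  have e1 : t * R * (K * K * K) = t * R * t + A₀ • (t * R * (K * K)) + A₁ • (t * R * K) +
      A₂ • (t * R) := by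
    rw [hK3]
    simp only [mul_add, mul_smul_comm, mul_one]
  have e2 : K * K * K * R * t = t * R * t + A₀ • (K * K * R * t) + A₁ • (K * R * t) +
      A₂ • (R * t) := by
    rw [hK3]
    simp only [add_mul, smul_mul_assoc, one_mul]
  have e3 := comm_tilde_sq (R := R) htK ht
  have e4 : X * t = X * (K * K * K) - A₀ • (X * (K * K)) - A₁ • (X * K) - A₂ • X := by
    conv_lhs => rw [ht]
    simp only [mul_sub, mul_smul_comm, mul_one]
  have e5 : t * X = K * K * K * X - A₀ • (K * K * X) - A₁ • (K * X) - A₂ • X := by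
    conv_lhs => rw [ht]
    simp only [sub_mul, smul_mul_assoc, one_mul]
  have key : X * t = t * X + w • (R * t * t - t * t * R) := by
    rw [e4, e5, x1, x2, x3, e1, e2, e3]
    module
  rw [hX] at key
  rw [key]
  simp only [mul_assoc]

/-- The reflection equation for `a K + b + K̃` with spectral parameters. -/
theorem reflection_of_coeffs (hR : R * R = w • R + 1) (hRK : R * K * R * K = K * R * K * R)
    (hKt : K * t = A₃ • 1) (htK : t * K = A₃ • 1)
    (ht : t = K * K * K - A₀ • (K * K) - A₁ • K - A₂ • 1)
    {x x' y y' s b b' : Z} (hx : x * x' = 1) (hy : y * y' = 1) (hs : s ^ 2 = -A₃)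
    (hb : (1 - x' ^ 2) * b = x' * (A₀ * s + A₂ * x))
    (hb' : (1 - y' ^ 2) * b' = y' * (A₀ * s + A₂ * y)) :
    (R - (x' * y) • (R - w • 1)) * ((x * s) • K + b • 1 + t) * (R - (x' * y') • (R - w • 1)) *
        ((y * s) • K + b' • 1 + t) =
      ((y * s) • K + b' • 1 + t) * (R - (x' * y') • (R - w • 1)) * ((x * s) • K + b • 1 + t) *
        (R - (x' * y) • (R - w • 1)) := by
  have hJt := commute_conj_tilde hRK ht
  have r1 := conj_mul_K hR hJt
  have r2 := conj_mul_tilde hR hRK hKt htK ht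
  have r3 : R * K * R * t = t * R * K * R := by
    rw [hJt.eq]
    simp only [mul_assoc]
  have e3 := comm_tilde_sq (R := R) htK ht
  obtain ⟨F, hF⟩ : ∃ F, F = (x * s) • K + b • 1 + t := ⟨_, rfl⟩
  obtain ⟨G, hG⟩ : ∃ G, G = (y * s) • K + b' • 1 + t := ⟨_, rfl⟩
  have q1 : R * F * R * G - G * R * F * R = w • ((b * (y * s)) • (R * K - K * R) +
      b • (R * t - t * R) + (y * s) • (t * R * K - K * R * t) + (R * t * t - t * t * R)) := by
    have hRK' : R * R * K = w • (R * K) + K := by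
      rw [hR, add_mul, smul_mul_assoc, one_mul]
    have hRt' : R * R * t = w • (R * t) + t := by
      rw [hR, add_mul, smul_mul_assoc, one_mul]
    have hRK'' : K * R * R = w • (K * R) + K := by
      rw [mul_assoc, hR, mul_add, mul_smul_comm, mul_one]
    have hRt'' : t * R * R = w • (t * R) + t := by
      rw [mul_assoc, hR, mul_add, mul_smul_comm, mul_one]
    rw [hF, hG]
    simp only [mul_add, add_mul, mul_smul_comm, smul_mul_assoc, mul_one, one_mul, r1, r2, r3, hRK,
      hRK', hRt', hRK'', hRt'']
    module
  have q2 : F * R * G - G * R * F = -((x * s) * b' - (y * s) * b) • (R * K - K * R) -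
      (x * s - y * s) • (t * R * K - K * R * t) + (b - b') • (R * t - t * R) := by
    rw [hF, hG]
    simp only [mul_add, add_mul, mul_smul_comm, smul_mul_assoc, mul_one, one_mul]
    module
  have hFG : F * G = G * F := by
    rw [hF, hG]
    simp only [mul_add, add_mul, mul_smul_comm, smul_mul_assoc, mul_one, one_mul, hKt, htK]
    module
  have q3 : R * F * G - G * F * R = ((x * s) * (y * s)) • (R * (K * K) - K * K * R) +
      ((x * s) * b' + (y * s) * b) • (R * K - K * R) + (b + b') • (R * t - t * R) +
      (R * t * t - t * t * R) := by
    have h1 : R * K * t = A₃ • R := by rw [mul_assoc, hKt, mul_smul_comm, mul_one]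
    have h2 : R * t * K = A₃ • R := by rw [mul_assoc, htK, mul_smul_comm, mul_one]
    rw [hF, hG]
    simp only [mul_add, add_mul, mul_smul_comm, smul_mul_assoc, mul_one, one_mul, hKt, htK, h1, h2,
      ← mul_assoc]
    module
  rw [← hF, ← hG, ← sub_eq_zero]
  -- Each spectral factor is `(1 - r) R + w r`, so the difference splits by the positions at which
  -- an `R` survives; the last term drops out because `F` and `G` commute.
  have expand : (R - (x' * y) • (R - w • 1)) * F * (R - (x' * y') • (R - w • 1)) * G -
      G * (R - (x' * y') • (R - w • 1)) * F * (R - (x' * y) • (R - w • 1)) =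
      ((1 - x' * y) * (1 - x' * y')) • (R * F * R * G - G * R * F * R) +
      (w * (x' * y) * (1 - x' * y')) • (F * R * G - G * R * F) +
      (w * (x' * y') * (1 - x' * y)) • (R * F * G - G * F * R) +
      (w ^ 2 * (x' * y) * (x' * y')) • (F * G - G * F) := by
    simp only [mul_sub, sub_mul, mul_smul_comm, smul_mul_assoc, mul_one, one_mul]
    module
  rw [expand, q1, q2, q3, hFG, sub_self, smul_zero, add_zero, e3]
  -- The four elements can now be treated as independent. The coefficients of `X₁` and `X₂` vanish
  -- by the formulas for `b` and `b'`, that of `X₃` because the coefficient of `K` is proportional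
  -- to the variable, and that of `X₄` because `s² = -A₃`.
  generalize R * K - K * R = X₁
  generalize R * t - t * R = X₂
  generalize t * R * K - K * R * t = X₃
  generalize R * (K * K) - K * K * R = X₄
  have c₁ : (1 - x' * y * (x' * y')) * (b * (y * s)) + (x' * y' - x' * y) * (x * s * b') -
      (1 - x' * y) * (A₀ * A₃) = 0 := by
    linear_combination (y * s) * hb - x * x' * y * s * hb' - x' ^ 2 * b * y * s * hy -
      x * s * x' * y' * b' * hy - (1 - x' * y) * A₀ * hs - A₀ * s ^ 2 * (x * x' * hy + hx) -
      x * x' * y * s * A₂ * hy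
  have c₂ : (1 - x' * y * (x' * y')) * b + (x' * y' - x' * y) * b' - (1 - x' * y) * A₂ = 0 := by
    linear_combination hb - x' * y * hb' - x' ^ 2 * b * hy - x' * y' * b' * hy -
      x' * A₀ * s * hy + A₂ * hx - A₂ * x' * y * hy
  have c₃ : (1 - x' * y') * (y * s - x' * y * (x * s)) = 0 := by
    linear_combination -(1 - x' * y') * y * s * hx
  have c₄ : (1 - x' * y) * (A₃ + x' * y' * (x * s * (y * s))) = 0 := by
    linear_combination (1 - x' * y) * (hs + s ^ 2 * (x * x' * hy + hx))
  calc _ = w • (((1 - x' * y * (x' * y')) * (b * (y * s)) + (x' * y' - x' * y) * (x * s * b') -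
          (1 - x' * y) * (A₀ * A₃)) • X₁ +
        ((1 - x' * y * (x' * y')) * b + (x' * y' - x' * y) * b' - (1 - x' * y) * A₂) • X₂ +
        ((1 - x' * y') * (y * s - x' * y * (x * s))) • X₃ +
        ((1 - x' * y) * (A₃ + x' * y' * (x * s * (y * s)))) • X₄) := by module
    _ = 0 := by
      rw [c₁, c₂, c₃, c₄]
      simp

/-- The reflection equation for `a K + b + K̃` with spectral parameters, with the scalars given by
a homomorphism into the centre. -/
theorem reflection_of_central {k Z H : Type*} [CommRing k] [CommRing Z] [Ring H] [Algebra k Z]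
    [Algebra k H] (ι : Z →ₐ[k] H) (hι : ∀ z h, ι z * h = h * ι z) {w A₀ A₁ A₂ A₃ : Z} {R K t : H}
    (hR : R * R = ι w * R + 1) (hRK : R * K * R * K = K * R * K * R)
    (hKt : K * t = ι A₃) (htK : t * K = ι A₃)
    (ht : t = K * K * K - ι A₀ * (K * K) - ι A₁ * K - ι A₂)
    {x x' y y' s b b' : Z} (hx : x * x' = 1) (hy : y * y' = 1) (hs : s ^ 2 = -A₃)
    (hb : (1 - x' ^ 2) * b = x' * (A₀ * s + A₂ * x))
    (hb' : (1 - y' ^ 2) * b' = y' * (A₀ * s + A₂ * y)) :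
    (R - ι (x' * y) * (R - ι w)) * (ι (x * s) * K + ι b + t) * (R - ι (x' * y') * (R - ι w)) *
        (ι (y * s) * K + ι b' + t) =
      (ι (y * s) * K + ι b' + t) * (R - ι (x' * y') * (R - ι w)) * (ι (x * s) * K + ι b + t) *
        (R - ι (x' * y) * (R - ι w)) := by
  -- The algebra structure is local, so that it cannot compete with other scalar actions on a tensor
  -- product.
  let _ : Algebra Z H := ι.toRingHom.toAlgebra' hι
  have hsm : ∀ (z : Z) (h : H), z • h = ι z * h := fun _ _ => rfl
  have h := reflection_of_coeffs (Z := Z) (R := R) (K := K) (t := t) hR hRK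
    (by rw [hKt, hsm, mul_one]) (by rw [htK, hsm, mul_one])
    (by rw [hsm, hsm, hsm, mul_one]; exact ht) hx hy hs hb hb'
  simpa only [hsm, mul_one] using h

end Existence

section TensorReflection

variable {k Z H E : Type*} [Field k] [CommRing Z] [Algebra k Z] [Ring H] [Algebra k H]
  [Algebra Z H] [CommRing E] [Algebra k E]

/-- The explicit solution of the reflection equation in an algebra extended by functions. -/
theorem reflection_tensor (ι : Z ⊗[k] E →ₐ[k] H ⊗[k] E) (hι : ∀ z h, ι z * h = h * ι z)
    (hιt : ∀ a f, ι (a ⊗ₜ f) = algebraMap Z H a ⊗ₜ f) {w A₀ A₁ A₂ A₃ s : Z} {R K t : H}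
    (hR : R ^ 2 = algebraMap Z H w * R + 1) (hRK : R * K * R * K = K * R * K * R)
    (hKt : K * t = algebraMap Z H A₃) (htK : t * K = algebraMap Z H A₃)
    (ht : t = K * K * K - algebraMap Z H A₀ * (K * K) - algebraMap Z H A₁ * K - algebraMap Z H A₂)
    {x x' y y' : E} {b b' : Z ⊗[k] E} (hx : x * x' = 1) (hy : y * y' = 1) (hs : s ^ 2 = -A₃)
    (hb : (1 - (1 ⊗ₜ x') ^ 2) * b = (1 ⊗ₜ x') * ((A₀ ⊗ₜ 1) * (s ⊗ₜ 1) + (A₂ ⊗ₜ 1) * (1 ⊗ₜ x)))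
    (hb' : (1 - (1 ⊗ₜ y') ^ 2) * b' =
      (1 ⊗ₜ y') * ((A₀ ⊗ₜ 1) * (s ⊗ₜ 1) + (A₂ ⊗ₜ 1) * (1 ⊗ₜ y))) :
    (R ⊗ₜ 1 - ι (1 ⊗ₜ (x' * y)) * (R ⊗ₜ 1 - ι (w ⊗ₜ 1))) *
        (ι ((1 ⊗ₜ x) * (s ⊗ₜ 1)) * (K ⊗ₜ 1) + ι b + t ⊗ₜ 1) *
        (R ⊗ₜ 1 - ι (1 ⊗ₜ (x' * y')) * (R ⊗ₜ 1 - ι (w ⊗ₜ 1))) *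
        (ι ((1 ⊗ₜ y) * (s ⊗ₜ 1)) * (K ⊗ₜ 1) + ι b' + t ⊗ₜ 1) =
      (ι ((1 ⊗ₜ y) * (s ⊗ₜ 1)) * (K ⊗ₜ 1) + ι b' + t ⊗ₜ 1) *
        (R ⊗ₜ 1 - ι (1 ⊗ₜ (x' * y')) * (R ⊗ₜ 1 - ι (w ⊗ₜ 1))) *
        (ι ((1 ⊗ₜ x) * (s ⊗ₜ 1)) * (K ⊗ₜ 1) + ι b + t ⊗ₜ 1) *
        (R ⊗ₜ 1 - ι (1 ⊗ₜ (x' * y)) * (R ⊗ₜ 1 - ι (w ⊗ₜ 1))) := by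
  have ex (a b : E) : (1 : Z) ⊗ₜ[k] (a * b) = (1 ⊗ₜ a) * (1 ⊗ₜ b) := by
    rw [Algebra.TensorProduct.tmul_mul_tmul, one_mul]
  rw [ex, ex]
  refine reflection_of_central ι hι (A₀ := A₀ ⊗ₜ 1) (A₁ := A₁ ⊗ₜ 1) (A₂ := A₂ ⊗ₜ 1)
    (A₃ := A₃ ⊗ₜ 1) ?_ ?_ ?_ ?_ ?_ ?_ ?_ ?_ hb hb'
  · rw [hιt, Algebra.TensorProduct.tmul_mul_tmul, Algebra.TensorProduct.tmul_mul_tmul, ← sq, hR,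
      mul_one, Algebra.TensorProduct.one_def, ← TensorProduct.add_tmul]
  · simp only [Algebra.TensorProduct.tmul_mul_tmul, hRK]
  · rw [hιt, Algebra.TensorProduct.tmul_mul_tmul, hKt, mul_one]
  · rw [hιt, Algebra.TensorProduct.tmul_mul_tmul, htK, mul_one]
  · simp only [Algebra.TensorProduct.tmul_mul_tmul, hιt, mul_one, ← TensorProduct.sub_tmul]
    rw [← ht]
  · rw [Algebra.TensorProduct.tmul_mul_tmul, hx, mul_one, Algebra.TensorProduct.one_def]
  · rw [Algebra.TensorProduct.tmul_mul_tmul, hy, mul_one, Algebra.TensorProduct.one_def]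
  · rw [Algebra.TensorProduct.tmul_pow, hs, one_pow, TensorProduct.neg_tmul]

end TensorReflection

/-! ### The explicit solution in `𝓗_p(x, y)` -/

section ExplicitSolution

variable {k 𝔷 : Type*} [Field k] [CommRing 𝔷] [Algebra k 𝔷] (q : k) (p : 𝔷[X])

/-- The structure map `𝔷(x, y) → 𝓗_p(x, y)`. -/
def scalXY : 𝔷 ⊗[k] Kxy k →ₐ[k] Hpxy q p :=
  Algebra.TensorProduct.map (IsScalarTower.toAlgHom k 𝔷 (Hp q p)) (AlgHom.id k (Kxy k))

theorem scalXY_tmul (a : 𝔷) (f : Kxy k) :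
    scalXY q p (a ⊗ₜ f) = algebraMap 𝔷 (Hp q p) a ⊗ₜ f := by
  simp [scalXY]

theorem scalXY_commute (z : 𝔷 ⊗[k] Kxy k) (h : Hpxy q p) :
    scalXY q p z * h = h * scalXY q p z := by
  induction z using TensorProduct.induction_on with
  | zero => simp
  | add a b ha hb => rw [map_add, add_mul, mul_add, ha, hb]
  | tmul a f =>
    induction h using TensorProduct.induction_on with
    | zero => simp
    | add a b ha hb => rw [add_mul, mul_add, ha, hb]
    | tmul h g =>
      rw [scalXY_tmul, Algebra.TensorProduct.tmul_mul_tmul, Algebra.TensorProduct.tmul_mul_tmul,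
        Algebra.commutes, mul_comm f]

theorem evalAt_scal (i : Fin 2) (a : 𝔷) (f : RatFunc k) :
    evalAt q p i (scal q p (a ⊗ₜ f)) = scalXY q p (a ⊗ₜ subst k i f) := by
  simp [evalAt, scal, scalXY]

theorem evalAt_const (i : Fin 2) (h : Hp q p) : evalAt q p i (const q p h) = h ⊗ₜ 1 := by
  simp [evalAt, const]

theorem var_ne_zero (i : Fin 2) : var k i ≠ 0 := fun h => by
  have := (aeval_var_injective k i) (a₁ := Polynomial.X) (a₂ := 0) (by simpa using h)
  exact Polynomial.X_ne_zero this

theorem var_sq_ne_one (i : Fin 2) : var k i ^ 2 ≠ 1 := fun h => by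
  have := (aeval_var_injective k i) (a₁ := Polynomial.X ^ 2) (a₂ := 1) (by simpa using h)
  have h0 := congrArg (Polynomial.eval 0) this
  simp at h0

theorem Ktilde_mul_genK (n : ℕ) (A : ℕ → 𝔷) :
    Ktilde q n A * genK q (poly n A) = algebraMap 𝔷 _ (A n) := by
  rw [← genK_mul_Ktilde, Ktilde_eq_aeval]
  calc _ = Polynomial.aeval (genK q (poly n A)) (tildePoly n A * Polynomial.X) := by
        rw [map_mul, Polynomial.aeval_X]
    _ = _ := by rw [mul_comm, map_mul, Polynomial.aeval_X]

/-- The denominator-free form of the constant coefficient required by `reflection_tensor`: `(1 -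
x⁻²) / (x - x⁻¹) = x⁻¹`. -/
theorem smallCoeff_mul (i : Fin 2) (a₀ a₂ s : 𝔷) : (1 - ((1 : 𝔷) ⊗ₜ[k] (var k i)⁻¹) ^ 2) *
      ((a₀ * s) ⊗ₜ (1 / (var k i - (var k i)⁻¹)) + a₂ ⊗ₜ (var k i / (var k i - (var k i)⁻¹))) =
      ((1 : 𝔷) ⊗ₜ (var k i)⁻¹) * ((a₀ ⊗ₜ 1) * (s ⊗ₜ 1) + (a₂ ⊗ₜ 1) * (1 ⊗ₜ var k i)) := by
  have h0 := var_ne_zero (k := k) i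
  have h1 : var k i ^ 2 - 1 ≠ 0 := sub_ne_zero.2 (var_sq_ne_one i)
  have h2 : var k i - (var k i)⁻¹ = (var k i ^ 2 - 1) / var k i := by field_simp
  have e1 : (1 - (var k i)⁻¹ ^ 2) * (1 / (var k i - (var k i)⁻¹)) = (var k i)⁻¹ := by
    rw [h2]
    field_simp
  have e2 : (1 - (var k i)⁻¹ ^ 2) * (var k i / (var k i - (var k i)⁻¹)) =
      (var k i)⁻¹ * var k i := by
    rw [h2]
    field_simp
  rw [Algebra.TensorProduct.one_def, Algebra.TensorProduct.tmul_pow, one_pow,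
    ← TensorProduct.tmul_sub, mul_add, mul_add]
  simp only [Algebra.TensorProduct.tmul_mul_tmul, one_mul, mul_one, e1, e2]

theorem scalXY_mul_tmul (a : 𝔷) (f : Kxy k) (h : Hp q p) (g : Kxy k) :
    scalXY q p (a ⊗ₜ f) * (h ⊗ₜ g) = (algebraMap 𝔷 _ a * h) ⊗ₜ (f * g) := by
  rw [scalXY_tmul, Algebra.TensorProduct.tmul_mul_tmul]

theorem Rspec_eq {τ z : Kxy k} (hz : τ⁻¹ = z) : Rspec q p τ = genR' q p ⊗ₜ 1 -
    scalXY q p (1 ⊗ₜ z) * (genR' q p ⊗ₜ 1 - scalXY q p (algebraMap k 𝔷 (q - q⁻¹) ⊗ₜ 1)) := by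
  rw [scalXY_tmul q p (algebraMap k 𝔷 (q - q⁻¹)), ← IsScalarTower.algebraMap_apply,
    ← TensorProduct.sub_tmul, scalXY_mul_tmul,
    map_one, one_mul, mul_one, ← hz]
  rfl

theorem evalAt_smallFormula (A : ℕ → 𝔷) (s : 𝔷) (i : Fin 2) :
    evalAt q (poly 3 A) i (smallFormula q 3 A s (Ktilde q 3 A)) =
      scalXY q (poly 3 A) ((1 ⊗ₜ var k i) * (s ⊗ₜ 1)) * (genK q (poly 3 A) ⊗ₜ 1) +
      scalXY q (poly 3 A) ((A 0 * s) ⊗ₜ (1 / (var k i - (var k i)⁻¹)) +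
        A 2 ⊗ₜ (var k i / (var k i - (var k i)⁻¹))) + Ktilde q 3 A ⊗ₜ 1 := by
  rw [smallFormula, map_add, map_add, map_mul, map_add (scal q (poly 3 A)),
    map_add (evalAt q (poly 3 A) i), evalAt_scal, evalAt_scal, evalAt_scal, evalAt_const,
    evalAt_const, map_add (scalXY q (poly 3 A)), Algebra.TensorProduct.tmul_mul_tmul, one_mul,
    mul_one]
  simp only [map_div₀, map_sub, map_inv₀, map_one, subst_X]

theorem Ktilde_three (A : ℕ → 𝔷) :
    Ktilde q 3 A = genK q (poly 3 A) * genK q (poly 3 A) * genK q (poly 3 A) -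
        algebraMap 𝔷 _ (A 0) * (genK q (poly 3 A) * genK q (poly 3 A)) -
        algebraMap 𝔷 _ (A 1) * genK q (poly 3 A) - algebraMap 𝔷 _ (A 2) := by
  rw [Ktilde, Finset.sum_range_succ, Finset.sum_range_succ, Finset.sum_range_one]
  simp only [Nat.sub_self, pow_zero, Nat.sub_zero, Nat.add_one_sub_one, pow_succ, one_mul,
    mul_one]
  abel

theorem smallFormula_isSolution {A : ℕ → 𝔷} {s : 𝔷} (hs : s ^ 2 = -A 3) :
    IsSolution q (poly 3 A) (smallFormula q 3 A s (Ktilde q 3 A)) := by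
  rw [IsSolution, Rspec_eq q _ (τ := var k 0 / var k 1) (z := (var k 0)⁻¹ * var k 1)
      (by rw [inv_div, div_eq_mul_inv, mul_comm]),
    Rspec_eq q _ (τ := var k 0 * var k 1) (mul_inv _ _), evalAt_smallFormula,
    evalAt_smallFormula]
  refine reflection_tensor (scalXY q (poly 3 A)) (scalXY_commute q (poly 3 A))
    (scalXY_tmul q (poly 3 A)) ?_ (genR'_mul_genK q _) (genK_mul_Ktilde q 3 A)
    (Ktilde_mul_genK q 3 A) (Ktilde_three q A) (mul_inv_cancel₀ (var_ne_zero 0))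
    (mul_inv_cancel₀ (var_ne_zero 1)) hs (smallCoeff_mul 0 _ _ _) (smallCoeff_mul 1 _ _ _)
  rw [genR'_sq, ← IsScalarTower.algebraMap_apply]

end ExplicitSolution

/-! ### Non-triviality through a commutative quotient -/

section Character

variable {k 𝔷 : Type*} [Field k] [CommRing 𝔷] [IsDomain 𝔷] [Algebra k 𝔷] {q : k} (n : ℕ)
  (A : ℕ → 𝔷)

/-- The commutative quotient of `𝓗_p` in which `R` is the scalar `q`. -/
def character (hq : q ≠ 0) : Hp q (poly n A) →ₐ[𝔷] RootAlg (FieldXY 𝔷) n A :=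
  -- The Hecke condition reads `q² = (q - q⁻¹) q + 1`, and the reflection relation is automatic in a
  -- commutative ring.
  liftHp q (poly n A) (algebraMap k _ q) (rt (FieldXY 𝔷) n A)
    (by
      rw [← map_pow, ← map_mul, ← map_one (algebraMap k (RootAlg (FieldXY 𝔷) n A)), ← map_add]
      congr 1
      field_simp
      ring)
    (by ring) (aeval_rt _ n A)

/-- The extension of `character` to `𝓗_p(x)`. -/
def characterX (hq : q ≠ 0) : Hpx q (poly n A) →ₐ[k] RootAlg (FieldXY 𝔷) n A :=
  Algebra.TensorProduct.lift ((character n A hq).restrictScalars k)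
    (((IsScalarTower.toAlgHom k (FieldXY 𝔷) (RootAlg (FieldXY 𝔷) n A)).comp (inclKxy k 𝔷)).comp
      (subst k 0))
    fun _ _ => Commute.all _ _

variable (hq : q ≠ 0)

theorem characterX_scal (e : Zx k 𝔷) :
    characterX n A hq (scal q (poly n A) e) = algebraMap (FieldXY 𝔷) _ (evalZx k 𝔷 0 e) := by
  induction e using TensorProduct.induction_on with
  | zero => simp only [map_zero]
  | tmul a f =>
    have : scal q (poly n A) (a ⊗ₜ f) = algebraMap 𝔷 (Hp q (poly n A)) a ⊗ₜ f := by
      simp [scal]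
    rw [this, evalZx_tmul, map_mul, characterX, Algebra.TensorProduct.lift_tmul,
      ← IsScalarTower.algebraMap_apply 𝔷 (FieldXY 𝔷)]
    exact congrArg (· * _) (AlgHom.commutes _ _)
  | add e f he hf => simp only [map_add, he, hf]

theorem characterX_const (h : Hp q (poly n A)) :
    characterX n A hq (const q (poly n A) h) = character n A hq h := by
  rw [const, characterX, Algebra.TensorProduct.includeLeft_apply,
    Algebra.TensorProduct.lift_tmul, map_one, mul_one]
  rfl

theorem character_genK : character n A hq (genK q (poly n A)) = rt (FieldXY 𝔷) n A := by
  rw [character, liftHp_genK]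

theorem character_Ktilde : character n A hq (Ktilde q n A) = rtTilde (FieldXY 𝔷) n A := by
  rw [Ktilde_eq_aeval, ← Polynomial.aeval_algHom_apply, character_genK, rtTilde]

/-- An element with coefficient `1` at `K̃` is not a scalar. -/
theorem not_isTrivial_of_Ktilde (hq : q ≠ 0) (hn : 2 ≤ n) (a b : Zx k 𝔷) :
    ¬ IsTrivial q (poly n A) (scal q (poly n A) a * const q (poly n A) (genK q (poly n A)) +
      scal q (poly n A) b + const q (poly n A) (Ktilde q n A)) := by
  rintro ⟨f, hf⟩
  obtain ⟨φ, h1, h0⟩ := exists_dual_tilde (FieldXY 𝔷) n A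
  have h := congrArg (fun e => φ (characterX n A hq e)) hf
  have e0 (c : FieldXY 𝔷) : φ (algebraMap (FieldXY 𝔷) _ c) = 0 := by
    rw [Algebra.algebraMap_eq_smul_one, map_smul, ← pow_zero (rt (FieldXY 𝔷) n A),
      h0 0 (by omega), smul_zero]
  have e1 : φ (rt (FieldXY 𝔷) n A) = 0 := by
    rw [← pow_one (rt (FieldXY 𝔷) n A), h0 1 (by omega)]
  simp only [map_add, map_mul, characterX_scal, characterX_const, character_genK,
    character_Ktilde, ← Algebra.smul_def, map_smul, e0, e1, h1, smul_zero, zero_add,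
    one_ne_zero] at h

end Character

/-! ### Smallness and the form with `K⁻¹` -/

section Small

variable {k 𝔷 : Type*} [Field k] [CommRing 𝔷] [Algebra k 𝔷] {q : k}

theorem smallFormula_isSmallSolution {A : ℕ → 𝔷} {s : 𝔷} (hs : s ^ 2 = -A 3) :
    IsSmallSolution q 3 A (smallFormula q 3 A s (Ktilde q 3 A)) := by
  refine ⟨smallFormula_isSolution q hs, by norm_num, fun j => if j = 0 then
    (A 0 * s) ⊗ₜ[k] (1 / (RatFunc.X - RatFunc.X⁻¹)) +
        A 2 ⊗ₜ[k] (RatFunc.X / (RatFunc.X - RatFunc.X⁻¹))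
    else if j = 1 then s ⊗ₜ[k] RatFunc.X else 0, 1, ?_, by norm_num⟩
  rw [sum_range_eq_of_two_le (by norm_num), smallFormula]
  · beta_reduce
    rw [if_pos rfl, if_neg one_ne_zero, if_pos rfl, pow_zero, pow_one, map_one, mul_one, map_one,
      one_mul, add_comm (scal q (poly 3 A) (s ⊗ₜ[k] RatFunc.X) * _)]
  · intro j hj _
    beta_reduce
    rw [if_neg (by omega), if_neg (by omega), map_zero, zero_mul]

theorem smallFormula_isNontrivialSmall [IsDomain 𝔷] (hq : q ≠ 0) {A : ℕ → 𝔷} {s : 𝔷}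
    (hs : s ^ 2 = -A 3) : IsNontrivialSmall q 3 A (smallFormula q 3 A s (Ktilde q 3 A)) :=
  ⟨smallFormula_isSmallSolution hs, not_isTrivial_of_Ktilde 3 A hq (by norm_num) _ _⟩

theorem smul_inv_genK {n : ℕ} {A : ℕ → 𝔷} {u : (Hp q (poly n A))ˣ}
    (hu : u.val = genK q (poly n A)) : A n • u⁻¹.val = Ktilde q n A := by
  rw [Algebra.smul_def, ← Ktilde_mul_genK q n A, ← hu, mul_assoc,
    Units.mul_inv, mul_one]

theorem const_smul (p : 𝔷[X]) (a : 𝔷) (h : Hp q p) :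
    const q p (a • h) = scal q p (a ⊗ₜ 1) * const q p h := by
  simp [const, scal, Algebra.smul_def]

end Small

theorem sub_inv_ne_zero {k : Type*} [Field k] {q : k} (hq0 : q ≠ 0) (hq1 : q ≠ 1)
    (hq2 : q ≠ -1) : q - q⁻¹ ≠ 0 := by
  intro h
  have h1 : q * q = 1 := by
    rw [sub_eq_zero] at h
    nth_rewrite 2 [h]
    exact mul_inv_cancel₀ hq0
  exact (mul_self_eq_one_iff.1 h1).elim hq1 hq2

end Baxter

end

theorem mainTheorem3 {k 𝔷 : Type*} [Field k] [CharZero k] [CommRing 𝔷] [IsDomain 𝔷]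
    [Algebra k 𝔷] (q : k) (hq0 : q ≠ 0) (hq1 : q ≠ 1) (hq2 : q ≠ -1)
    (n : ℕ) (hn : 1 ≤ n) (A : ℕ → 𝔷) (hA : (Baxter.poly n A).eval 0 ≠ 0) :
    -- the shape of a non-trivial small solution, with `K̃` in the role of `A_n K⁻¹`
    (∀ F : Baxter.Hpx q (Baxter.poly n A), Baxter.IsNontrivialSmall q n A F →
      ∃ a b c : Baxter.Zx k 𝔷,
        F = Baxter.scal q (Baxter.poly n A) a *
              Baxter.const q (Baxter.poly n A) (Baxter.genK q (Baxter.poly n A)) +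
            Baxter.scal q (Baxter.poly n A) b +
            Baxter.scal q (Baxter.poly n A) c *
              Baxter.const q (Baxter.poly n A) (Baxter.Ktilde q n A)) ∧
    -- the same with `K⁻¹`, when `K` is invertible
    (∀ u : (Baxter.Hp q (Baxter.poly n A))ˣ, u.val = Baxter.genK q (Baxter.poly n A) →
      ∀ F : Baxter.Hpx q (Baxter.poly n A), Baxter.IsNontrivialSmall q n A F →
      ∃ a b c : Baxter.Zx k 𝔷,
        F = Baxter.scal q (Baxter.poly n A) a *
              Baxter.const q (Baxter.poly n A) (Baxter.genK q (Baxter.poly n A)) +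
            Baxter.scal q (Baxter.poly n A) b +
            Baxter.scal q (Baxter.poly n A) c *
              Baxter.const q (Baxter.poly n A) u⁻¹.val) ∧
    -- a non-trivial small solution exists only for `n = 3`
    ((∃ F : Baxter.Hpx q (Baxter.poly n A), Baxter.IsNontrivialSmall q n A F) → n = 3) ∧
    -- for `n = 3`: the explicit solution, and its uniqueness up to a factor and the choice of
    -- the square root `s` of `-A_3`
    (n = 3 → ∀ s : 𝔷, s ^ 2 = -A 3 →
      Baxter.IsNontrivialSmall q n A (Baxter.smallFormula q n A s (Baxter.Ktilde q n A)) ∧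
      (∀ F : Baxter.Hpx q (Baxter.poly n A), Baxter.IsNontrivialSmall q n A F →
        ∃ f : Baxter.Zx k 𝔷,
          F = Baxter.scal q (Baxter.poly n A) f *
                Baxter.smallFormula q n A s (Baxter.Ktilde q n A) ∨
          F = Baxter.scal q (Baxter.poly n A) f *
                Baxter.smallFormula q n A (-s) (Baxter.Ktilde q n A)) ∧
      (∀ u : (Baxter.Hp q (Baxter.poly n A))ˣ, u.val = Baxter.genK q (Baxter.poly n A) →
        Baxter.IsNontrivialSmall q n A (Baxter.smallFormula q n A s (A 3 • u⁻¹.val)) ∧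
        ∀ F : Baxter.Hpx q (Baxter.poly n A), Baxter.IsNontrivialSmall q n A F →
          ∃ f : Baxter.Zx k 𝔷,
            F = Baxter.scal q (Baxter.poly n A) f *
                  Baxter.smallFormula q n A s (A 3 • u⁻¹.val) ∨
            F = Baxter.scal q (Baxter.poly n A) f *
                  Baxter.smallFormula q n A (-s) (A 3 • u⁻¹.val))) := by
  rw [Baxter.poly_eval_zero] at hA
  have hq := Baxter.sub_inv_ne_zero hq0 hq1 hq2
  refine ⟨fun F hF => ?_, fun u hu F hF => ?_, fun ⟨F, hF⟩ => hF.eq_three hq hA, ?_⟩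
  · obtain ⟨-, a, b, d, -, h, -⟩ := hF.1.shape hq hA
    exact ⟨a, b, d, h⟩
  · obtain ⟨-, a, b, d, -, h, -⟩ := hF.1.shape hq hA
    -- Since `K̃ = A_n K⁻¹`, the coefficient of `K⁻¹` absorbs the constant `A_n`.
    refine ⟨a, b, d * (A n ⊗ₜ 1), ?_⟩
    rw [h, ← Baxter.smul_inv_genK hu, Baxter.const_smul, map_mul, mul_assoc (Baxter.scal q _ d)]
  · rintro rfl s hs
    refine ⟨Baxter.smallFormula_isNontrivialSmall hq0 hs, fun F hF => hF.eq_smul hq hA hs,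
      fun u hu => ?_⟩
    rw [Baxter.smul_inv_genK hu]
    exact ⟨Baxter.smallFormula_isNontrivialSmall hq0 hs, fun F hF => hF.eq_smul hq hA hs⟩
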